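/- **Setting.** $\mathbb{R}^4_1$ is $\mathbb{R}^4$ with $\langle x,y\rangle=-x_0y_0+x_1y_1+x_2y_2+x_3y_3$, $\|x\|=\sqrt{|\langle x,x\rangle|}$, canonical basis $e_0,\dots,e_3$, and $x\wedge y\wedge z$ is the vector given by the formal determinant with rows $(-e_0,e_1,e_2,e_3),x,y,z$. Let $H^3(-1)=\{x:\langle x,x\rangle=-1\}$ and $HP(v,c)=\{x:\langle x,v\rangle=c\}$. Let $X:U\to\mathbb{R}^4_1$ be a smooth spacelike embedding of an open set $U\subset\mathbb{R}^3$ (every nonzero tangent vector is spacelike), $M=X(U)$, whose unit normal $n=\dfrac{X_{u_1}\wedge X_{u_2}\wedge X_{u_3}}{\|X_{u_1}\wedge X_{u_2}\wedge X_{u_3}\|}$ is future directed, $\langle n,e_0\rangle<0$. Let $\bar\gamma:I\to U$ be a smooth curve on an open interval $I$ such that $\gamma=X\circ\bar\gamma:I\to M$ has unit speed. Put $n_\gamma=n\circ\bar\gamma$, $t=\gamma'$, $k_n=-\langle n_\gamma,t'\rangle$, $k_g=\|\langle n_\gamma,t'\rangle n_\gamma+t'\|$, $n_1=k_g^{-1}(\langle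 n_\gamma,t'\rangle n_\gamma+t')$, $n_2=n_\gamma\wedge t\wedge n_1$, $\tau_1=\langle n_1,n_\gamma'\rangle$, $\tau_2=\langle n_2,n_\gamma'\rangle$, $\tau_g=\langle -n_2',n_1\rangle$ and $\lambda_0=k_gk_n'+k_g^2\tau_1-k_n^2\tau_1-k_nk_g'$. Assume that for all $s\in I$ $$k_g(s)\ne0,\qquad (k_n\tau_2+k_g\tau_g)(s)\neq0,\qquad k_g^2(s)>k_n^2(s).$$ For $v\in H^3(-1)$ let $(h^T_t)_v(s)=\langle t(s),v\rangle$. The hyperbolic surface of $\gamma$ is $$S_\gamma(s,\theta)=\frac{\cosh\theta}{\sqrt{k_g^2(s)-k_n^2(s)}}\bigl(k_g(s)n_\gamma(s)+k_n(s)n_1(s)\bigr)+\sinh\theta\, n_2(s)\in H^3(-1),$$ and the hyperbolic curve is $CH_\gamma(s)=S_\gamma(s,\theta(s))$ with $\tanh\theta(s)=\dfrac{\lambda_0(s)}{(k_n\tau_2+k_g\tau_g)(s)\sqrt{k_g^2(s)-k_n^2(s)}}$, defined where the right-hand side has absolute value less than $1$. A function $f$ has an $A_k$-singularity at $s_0$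 if $f(s_0)=f'(s_0)=\dots=f^{(k)}(s_0)=0$ and $f^{(k+1)}(s_0)\ne0$. For $v\ne0$, the curve $\gamma$ and the slice $M\cap HP(v,c)$ have contact of order $k$ at $s_0$ if $g(s)=\langle\gamma(s),v\rangle-c$ has an $A_k$-singularity at $s_0$. The curve $CH_\gamma$ is, at $s_0$, locally diffeomorphic to a set $C\subset\mathbb{R}^3$ with $0\in C$ if some smooth diffeomorphism from a neighbourhood of $CH_\gamma(s_0)$ in $H^3(-1)$ onto a neighbourhood of $0$ in $\mathbb{R}^3$ takes the point $CH_\gamma(s_0)$ to $0$ and the germ of the image of $CH_\gamma$ at $s_0$ to the germ of $C$ at $0$. Let $C(2,3,4)=\{(r^2,r^3,r^4): r\in\mathbb{R}\}$. **Proposition 3.7.** Let $s_0\in I$, $\theta_0\in\mathbb{R}$, $v_0=S_\gamma(s_0,\theta_0)$, $c=\langle\gamma(s_0),v_0\rangle$ and $g(s)=\langle\gamma(s),v_0\rangle-c$. 1. $\gamma$ and the spacelike slice $M\cap HP(v_0,c)$ have contact of order at least $3$ at $s_0$ if and only if $(h^T_t)_{v_0}$ has an $A_k$-singularity at $s_0$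 with $k\ge2$. This holds in both readings: (i) the contact has some finite order $k\ge3$ if and only if $(h^T_t)_{v_0}$ has an $A_k$-singularity for some finite $k\ge 2$; (ii) (infinite order included) $g$ and its first three derivatives vanish at $s_0$ if and only if $(h^T_t)_{v_0}$ and its first two derivatives vanish at $s_0$. Furthermore, if the contact has order exactly $3$ at $s_0$, then $CH_\gamma$ is defined near $s_0$, $CH_\gamma(s_0)=v_0$, and $CH_\gamma$ is, at $s_0$, locally diffeomorphic to a line. 2. $\gamma$ and $M\cap HP(v_0,c)$ have contact of order $4$ at $s_0$ if and only if $(h^T_t)_{v_0}$ has an $A_3$-singularity at $s_0$. In this case, if $\lambda_0(s_0)\neq0$, then $CH_\gamma$ is defined near $s_0$, $CH_\gamma(s_0)=v_0$, and $CH_\gamma$ is, at $s_0$, locally diffeomorphic to the $(2,3,4)$-cusp $C(2,3,4)$. -/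

import Mathlib

open scoped ContDiff Topology

noncomputable section

namespace Minkowski

/-- The underlying vector space of Minkowski 4-space (only its topology and smooth structure, which
do not depend on the choice of a norm, are used). -/
abbrev R41 : Type := Fin 4 → ℝ

abbrev R3 : Type := Fin 3 → ℝ

/-- The pseudo-scalar product of signature (-,+,+,+). -/
def inn (x y : R41) : ℝ := -(x 0 * y 0) + x 1 * y 1 + x 2 * y 2 + x 3 * y 3

/-- The pseudo-norm. -/
def pnorm (x : R41) : ℝ := Real.sqrt |inn x x|

/-- The first vector of the canonical basis. -/
def e0 : R41 := Pi.single 0 1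

/-- The pseudo vector product: the `i`-th component is the coefficient of the `i`-th basis vector in
the formal determinant with rows `(-e₀, e₁, e₂, e₃)`, `x`, `y`, `z`. -/
def wedge (x y z : R41) : R41 := fun i =>
  Matrix.det (Matrix.of ![Pi.single i (if i = 0 then (-1 : ℝ) else 1), x, y, z])

/-- The hyperplane with pseudo-normal `v` at level `c`. -/
def HP (v : R41) (c : ℝ) : Set R41 := {x | inn x v = c}

/-- Hyperbolic 3-space, as the set of all unit timelike vectors. -/
def H3 : Set R41 := {x | inn x x = -1}

/-! ### Singularities of functions of one variable, and contact -/

/-- The function `f` vanishes at `s₀` together with its derivatives of order at most `k`. -/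
def VanishesToOrder (f : ℝ → ℝ) (k : ℕ) (s₀ : ℝ) : Prop :=
  ∀ i ≤ k, iteratedDeriv i f s₀ = 0

/-- The function `f` has an `A_k`-singularity at `s₀`. -/
def HasASingularity (f : ℝ → ℝ) (k : ℕ) (s₀ : ℝ) : Prop :=
  VanishesToOrder f k s₀ ∧ iteratedDeriv (k + 1) f s₀ ≠ 0

/-- The curve `γ` and the zero set of the submersion `F` have contact of order (exactly) `k`
at `s₀`. -/
def HasContact (F : R41 → ℝ) (γ : ℝ → R41) (k : ℕ) (s₀ : ℝ) : Prop :=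
  HasASingularity (F ∘ γ) k s₀

/-- The affine function `D_v(x) = ⟨x, v⟩ - c`. For `v ≠ 0` it is a submersion, and its zero set is
the hyperplane `HP v c`; so its zero set in `M` is the slice `M ∩ HP v c`. -/
def heightFn (v : R41) (c : ℝ) (x : R41) : ℝ := inn x v - c

theorem zeroSet_heightFn (v : R41) (c : ℝ) : {x | heightFn v c x = 0} = HP v c := by
  ext x
  simp [heightFn, HP, sub_eq_zero]

/-! ### Curves in spacelike hypersurfaces -/

/-- The partial derivative of `X` in the direction of the `i`-th coordinate. -/
def partialD (X : R3 → R41) (i : Fin 3) (u : R3) : R41 := fderiv ℝ X u (Pi.single i 1)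

/-- The unit normal field of the parametrized hypersurface `X`, as a function of the parameter. -/
def unitNormal (X : R3 → R41) (u : R3) : R41 :=
  (pnorm (wedge (partialD X 0 u) (partialD X 1 u) (partialD X 2 u)))⁻¹ •
    wedge (partialD X 0 u) (partialD X 1 u) (partialD X 2 u)

/-- `X` is a smooth spacelike embedding of the open set `U`, oriented by its future directed unit
normal field. -/
structure IsSpacelikeEmbedding (U : Set R3) (X : R3 → R41) : Prop where
  isOpen : IsOpen U
  contDiffOn : ContDiffOn ℝ ∞ X U
  isEmbedding : Topology.IsEmbedding (U.domRestrict X)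
  immersion : ∀ u ∈ U, Function.Injective (fderiv ℝ X u)
  spacelike : ∀ u ∈ U, ∀ w : R3, fderiv ℝ X u w ≠ 0 →
    0 < inn (fderiv ℝ X u w) (fderiv ℝ X u w)
  future : ∀ u ∈ U, inn (unitNormal X u) e0 < 0

/-- A smooth unit speed curve `γ = X ∘ γbar : I → M` in a spacelike hypersurface `M = X(U)`, where
`I` is an open interval and `γbar : I → U`. (Values of `X` outside `U` and of `γbar` outside `I`
play no role. The curve `γbar` is regular because `γ` has unit speed.) -/
structure CurveInHypersurface where
  U : Set R3
  X : R3 → R41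
  embedding : IsSpacelikeEmbedding U X
  I : Set ℝ
  isOpen_I : IsOpen I
  interval_I : I.OrdConnected
  γbar : ℝ → R3
  smooth_γbar : ContDiffOn ℝ ∞ γbar I
  mapsTo_γbar : Set.MapsTo γbar I U
  unitSpeed : ∀ s ∈ I, inn (deriv (X ∘ γbar) s) (deriv (X ∘ γbar) s) = 1

namespace CurveInHypersurface

variable (Γ : CurveInHypersurface)

/-- The hypersurface `M`. -/
def M : Set R41 := Γ.X '' Γ.U

/-- The curve `γ` in `M`. -/
def γ : ℝ → R41 := Γ.X ∘ Γ.γbar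

/-- The future directed unit normal of `M` along the curve. -/
def nγ (s : ℝ) : R41 := unitNormal Γ.X (Γ.γbar s)

/-- The unit tangent vector. -/
def t (s : ℝ) : R41 := deriv Γ.γ s

/-- The normal curvature. -/
def kn (s : ℝ) : ℝ := -inn (Γ.nγ s) (deriv Γ.t s)

/-- The geodesic curvature. -/
def kg (s : ℝ) : ℝ := pnorm (inn (Γ.nγ s) (deriv Γ.t s) • Γ.nγ s + deriv Γ.t s)

/-- The third vector of the Lorentzian Darboux frame `nγ, t, n1, n2`. -/
def n1 (s : ℝ) : R41 :=
  (Γ.kg s)⁻¹ • (inn (Γ.nγ s) (deriv Γ.t s) • Γ.nγ s + deriv Γ.t s)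

/-- The fourth vector of the Lorentzian Darboux frame. -/
def n2 (s : ℝ) : R41 := wedge (Γ.nγ s) (Γ.t s) (Γ.n1 s)

/-- The first normal torsion. -/
def τ1 (s : ℝ) : ℝ := inn (Γ.n1 s) (deriv Γ.nγ s)

/-- The second normal torsion. -/
def τ2 (s : ℝ) : ℝ := inn (Γ.n2 s) (deriv Γ.nγ s)

/-- The geodesic torsion. -/
def τg (s : ℝ) : ℝ := inn (-deriv Γ.n2 s) (Γ.n1 s)

/-- The timelike tangential height function `(h_t^T)_v`. -/
def hT (v : R41) (s : ℝ) : ℝ := inn (Γ.t s) v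

/-- The hyperbolic surface `S_γ`. -/
def S (s θ : ℝ) : R41 :=
  (Real.cosh θ / Real.sqrt (Γ.kg s ^ 2 - Γ.kn s ^ 2)) • (Γ.kg s • Γ.nγ s + Γ.kn s • Γ.n1 s)
    + Real.sinh θ • Γ.n2 s

/-- The invariant `λ₀`. -/
def lam0 (s : ℝ) : ℝ :=
  Γ.kg s * deriv Γ.kn s + Γ.kg s ^ 2 * Γ.τ1 s - Γ.kn s ^ 2 * Γ.τ1 s - Γ.kn s * deriv Γ.kg s

/-- The prescribed value of `tanh (θ(s))` along the hyperbolic curve. -/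
def tanhAngle (s : ℝ) : ℝ :=
  Γ.lam0 s /
    ((Γ.kn s * Γ.τ2 s + Γ.kg s * Γ.τg s) * Real.sqrt (Γ.kg s ^ 2 - Γ.kn s ^ 2))

/-- The hyperbolic curve `CH_γ(s) = S_γ(s, θ(s))`, where `tanh (θ(s)) = tanhAngle s`. It is defined
at those `s` for which `|tanhAngle s| < 1`. -/
def CH (s : ℝ) : R41 := Γ.S s (Real.artanh (Γ.tanhAngle s))

end CurveInHypersurface

/-! ### Local diffeomorphism type of a curve in a 3-dimensional submanifold -/

/-- The germ at `s₀` of the image of the curve `c`, which lies in the 3-dimensional submanifold `N`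
of `ℝ⁴`, is diffeomorphic to the germ of the set `C ⊆ ℝ³` at `q`: there is a diffeomorphism `Φ`,
with inverse `Ψ`, from an open neighbourhood `N ∩ Ω` of `c s₀` in `N` onto an open neighbourhood `W`
of `q` in `ℝ³` that takes `c s₀` to `q` and takes `c(J)`, for all small neighbourhoods `J` of `s₀`,
to a set that agrees with `C` near `q`. -/
def ImageGermDiffeomorphic (N : Set R41) (c : ℝ → R41) (s₀ : ℝ) (C : Set R3) (q : R3) : Prop :=
  ∃ (Ω : Set R41) (W : Set R3) (Φ : R41 → R3) (Ψ : R3 → R41),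
    IsOpen Ω ∧ IsOpen W ∧ ContDiffOn ℝ ∞ Φ Ω ∧ ContDiffOn ℝ ∞ Ψ W ∧
    Set.MapsTo Φ (N ∩ Ω) W ∧ Set.MapsTo Ψ W (N ∩ Ω) ∧ Set.InvOn Ψ Φ (N ∩ Ω) W ∧
    Φ (c s₀) = q ∧
    ∃ J₀ ∈ 𝓝 s₀, Set.MapsTo c J₀ (N ∩ Ω) ∧
      ∀ J ∈ 𝓝 s₀, J ⊆ J₀ → ∀ᶠ y in 𝓝 q, (y ∈ Φ '' (c '' J) ↔ y ∈ C)

/-- A line in `ℝ³` through the origin. -/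
def lineModel : Set R3 := Set.range fun r : ℝ => ![r, 0, 0]

/-- The `(2,3,4)`-cusp. -/
def cusp234 : Set R3 := Set.range fun r : ℝ => ![r ^ 2, r ^ 3, r ^ 4]

end Minkowski

end

/-!
All assertions come down to the derivatives at `s₀` of the function `⟨t, v₀⟩`, where
`v₀ = S s₀ θ₀`. The derivative of the height function along `γ` is `⟨t, v₀⟩`, and the height
function itself vanishes at `s₀` by the choice of `c`; this gives the equivalences between the orders
of vanishing (`vanishesToOrder_succ_heightFn_iff`, `hasContact_succ_iff`).

The structure equations of the Darboux frame show that `S s θ` is always a unit timelike vector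
orthogonal to `t` and `t'`, and that it is orthogonal to `t''` exactly if `tanh θ` is the value that
defines the hyperbolic curve (`inn_deriv_deriv_t_S_eq_zero_iff`). So `V = CH` is the curve in
hyperbolic space that is orthogonal to `t`, `t'` and `t''`. At each point of it the vectors
`t, t', t'', V` are a basis (`eq_zero_of_orthogonal`), so that `⟨t'' s₀, ·⟩`, `⟨t' s₀, ·⟩`,
`⟨t s₀, ·⟩` are coordinates of hyperbolic space near `v₀`. Differentiating the three orthogonality
relations (`inn_iteratedDeriv_relations`) gives the orders of vanishing of these coordinates along
`V`:

* `⟨t'', V'⟩ = -⟨t''', V⟩`, so for contact of order 3 the curve `V` is regular at `s₀`;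
* if `⟨t''', V⟩ = 0` at `s₀`, then `V' = 0` there, and the first coordinate has second derivative
  `-⟨t'''', V⟩`, while the second coordinate vanishes together with its first two derivatives and
  has third derivative `2⟨t'''', V⟩`. So for contact of order 4 the coordinates of `V` start with
  powers 2, 3 and at least 2 of `s - s₀`.

It remains to bring such a germ to the normal form `(r², r³, r⁴)` (`exists_cusp_coordinates`). The
parameter `r` is a square root of the first coordinate. By Whitney's theorem on even functions
(`exists_smooth_eq_comp_sq`), which rests on Borel's lemma (`exists_smooth_iteratedDeriv_zero_eq`),
a smooth function of `r` is `A(r²) + r B(r²)` with smooth `A` and `B`. So the second coordinate is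
`r³ A(r²) + r⁴ B(r²)` with `A 0 ≠ 0` and the third is `r² A'(r²) + r³ B'(r²)`; a triangular change of
coordinates turns them into `r³` and `r⁴`. The exact order of the third coordinate plays no role
because the model cusp lies on a smooth surface. The change of coordinates is a chart of hyperbolic
space by the inverse function theorem (`exists_chart`).
-/

/-! ### Smooth functions of one variable -/

theorem iteratedDeriv_eq_of_hasDerivAt_succ {G : ℕ → ℝ → ℝ}
    (hG : ∀ k x, HasDerivAt (G k) (G (k + 1) x) x) (k : ℕ) : iteratedDeriv k (G 0) = G k := by
  induction k with
  | zero => simp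
  | succ k ih =>
    rw [iteratedDeriv_succ, ih]
    exact funext fun x => (hG k x).deriv

/-- A function is smooth as soon as it starts a sequence of functions each of which is the
derivative of the one before. -/
theorem contDiff_of_hasDerivAt_succ {G : ℕ → ℝ → ℝ}
    (hG : ∀ k x, HasDerivAt (G k) (G (k + 1) x) x) : ContDiff ℝ ∞ (G 0) := by
  refine contDiff_of_differentiable_iteratedDeriv fun m _ => ?_
  rw [iteratedDeriv_eq_of_hasDerivAt_succ hG]
  exact fun x => (hG m x).differentiableAt

theorem ContDiff.hasDerivAt_iteratedDeriv {f : ℝ → ℝ} (hf : ContDiff ℝ ∞ f) (k : ℕ) (x : ℝ) :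
    HasDerivAt (iteratedDeriv k f) (iteratedDeriv (k + 1) f x) x := by
  rw [iteratedDeriv_succ]
  exact (hf.differentiable_iteratedDeriv k (by exact_mod_cast WithTop.coe_lt_top _) x).hasDerivAt

theorem ContDiff.smooth_iteratedDeriv {f : ℝ → ℝ} (hf : ContDiff ℝ ∞ f) (k : ℕ) :
    ContDiff ℝ ∞ (iteratedDeriv k f) := by
  simpa using contDiff_of_hasDerivAt_succ (G := fun j => iteratedDeriv (k + j) f)
    fun j x => hf.hasDerivAt_iteratedDeriv (k + j) x

/-- **Hadamard's lemma**: a smooth function that vanishes at `0` is divisible by the coordinate,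
and the derivatives of the quotient at `0` are known. -/
theorem exists_smooth_eq_mul {f : ℝ → ℝ} (hf : ContDiff ℝ ∞ f) (h0 : f 0 = 0) :
    ∃ h : ℝ → ℝ, ContDiff ℝ ∞ h ∧ (∀ x, f x = x * h x) ∧
      ∀ k, iteratedDeriv k h 0 = iteratedDeriv (k + 1) f 0 / (k + 1) := by
  set H : ℕ → ℝ → ℝ := fun k x => ∫ t in (0 : ℝ)..1, t ^ k * iteratedDeriv (k + 1) f (t * x)
    with hH
  have hc : ∀ k, Continuous (iteratedDeriv k f) := fun k => (hf.smooth_iteratedDeriv k).continuous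
  have hd : ∀ k x, HasDerivAt (H k) (H (k + 1) x) x := by
    intro k x
    obtain ⟨C, hC⟩ := ((isCompact_Icc (a := (-(|x| + 1))) (b := |x| + 1)).bddAbove_image
      (f := fun y => |iteratedDeriv (k + 2) f y|) (hc _).abs.continuousOn)
    refine (intervalIntegral.hasDerivAt_integral_of_dominated_loc_of_deriv_le
      (F := fun x t => t ^ k * iteratedDeriv (k + 1) f (t * x))
      (F' := fun x t => t ^ (k + 1) * iteratedDeriv (k + 2) f (t * x))
      (bound := fun _ => C) (s := Metric.ball x 1) (Metric.ball_mem_nhds x one_pos)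
      ?_ ?_ ?_ ?_ ?_ ?_).2
    · refine Filter.Eventually.of_forall fun y => ?_
      have := hc (k + 1)
      exact (by fun_prop : Continuous fun t : ℝ =>
        t ^ k * iteratedDeriv (k + 1) f (t * y)).aestronglyMeasurable
    · have := hc (k + 1)
      exact (by fun_prop : Continuous fun t : ℝ =>
        t ^ k * iteratedDeriv (k + 1) f (t * x)).intervalIntegrable _ _
    · have := hc (k + 2)
      exact (by fun_prop : Continuous fun t : ℝ =>
        t ^ (k + 1) * iteratedDeriv (k + 2) f (t * x)).aestronglyMeasurable
    · refine Filter.Eventually.of_forall fun t ht y hy => ?_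
      rw [Set.uIoc_of_le zero_le_one] at ht
      have hy' : |y| ≤ |x| + 1 := by
        rw [Metric.mem_ball, Real.dist_eq] at hy
        calc |y| = |x + (y - x)| := by ring_nf
          _ ≤ |x| + |y - x| := abs_add_le _ _
          _ ≤ _ := by linarith
      have ht1 : |t| ≤ 1 := abs_le.2 ⟨by linarith [ht.1], ht.2⟩
      have hty : t * y ∈ Set.Icc (-(|x| + 1)) (|x| + 1) := by
        refine abs_le.1 ?_
        rw [abs_mul]
        calc |t| * |y| ≤ 1 * |y| := by gcongr
          _ ≤ _ := by linarith
      have h1 := hC (Set.mem_image_of_mem _ hty)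
      rw [Real.norm_eq_abs, abs_mul, abs_pow]
      calc |t| ^ (k + 1) * |iteratedDeriv (k + 2) f (t * y)|
          ≤ 1 * |iteratedDeriv (k + 2) f (t * y)| := by
            gcongr
            exact pow_le_one₀ (abs_nonneg _) ht1
        _ ≤ C := by simpa using h1
    · simp
    · refine Filter.Eventually.of_forall fun t _ y _ => ?_
      have h1 : HasDerivAt (fun y => t * y) t y := by simpa using (hasDerivAt_id y).const_mul t
      have h2 := ((hf.hasDerivAt_iteratedDeriv (k + 1) (t * y)).comp y h1).const_mul (t ^ k)
      exact h2.congr_deriv (by ring)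
  refine ⟨H 0, contDiff_of_hasDerivAt_succ hd, fun x => ?_, fun k => ?_⟩
  · have h1 : ∀ t ∈ Set.uIcc (0 : ℝ) 1, HasDerivAt (fun t => f (t * x))
        (x * iteratedDeriv 1 f (t * x)) t := by
      intro t _
      have h1 : HasDerivAt (fun t => t * x) x t := by simpa using (hasDerivAt_id t).mul_const x
      have h2 := (hf.hasDerivAt_iteratedDeriv 0 (t * x)).comp t h1
      rw [iteratedDeriv_zero] at h2
      exact h2.congr_deriv (by ring)
    have h2 := intervalIntegral.integral_eq_sub_of_hasDerivAt h1 (by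
      have := hc 1
      exact (by fun_prop : Continuous fun t : ℝ =>
        x * iteratedDeriv 1 f (t * x)).intervalIntegrable _ _)
    simp only [hH, pow_zero, one_mul, zero_add]
    rw [intervalIntegral.integral_const_mul] at h2
    simpa [h0] using h2.symm
  · rw [iteratedDeriv_eq_of_hasDerivAt_succ hd]
    simp only [hH, mul_zero]
    rw [intervalIntegral.integral_mul_const, integral_pow]
    simp
    ring

/-- **Borel's lemma**: every sequence is the sequence of derivatives at `0` of a smooth function. -/
theorem exists_smooth_iteratedDeriv_zero_eq (a : ℕ → ℝ) :
    ∃ h : ℝ → ℝ, ContDiff ℝ ∞ h ∧ ∀ k, iteratedDeriv k h 0 = a k := by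
  let χ : ContDiffBump (0 : ℝ) := ⟨1, 2, one_pos, one_lt_two⟩
  let ρ : ℕ → ℝ → ℝ := fun n y => y ^ n * χ y
  have hρ : ∀ n, ContDiff ℝ ∞ (ρ n) := fun n => (contDiff_id.pow n).mul χ.contDiff
  have hρ0 : ∀ n k, iteratedDeriv k (ρ n) 0 = if k = n then (n.factorial : ℝ) else 0 := by
    intro n k
    have h1 : ρ n =ᶠ[𝓝 0] fun y => y ^ n := by
      filter_upwards [χ.eventuallyEq_one] with y hy
      simp [ρ, hy]
    rw [h1.iteratedDeriv_eq, iteratedDeriv_fun_pow_zero]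
    split_ifs <;> simp
  have hb : ∀ n k, ∃ C, ∀ x, |iteratedDeriv k (ρ n) x| ≤ C := by
    intro n k
    have hs : HasCompactSupport (ρ n) := χ.hasCompactSupport.mul_left
    have hs' : HasCompactSupport (iteratedDeriv k (ρ n)) := by
      rw [iteratedDeriv_eq_iterate]
      induction k with
      | zero => simpa using hs
      | succ k ih => rw [Function.iterate_succ_apply']; exact ih.deriv
    exact hs'.exists_bound_of_continuous ((hρ n).smooth_iteratedDeriv k).continuous
  choose C hC using hb
  have hC0 : ∀ n k, 0 ≤ C n k := fun n k => (abs_nonneg _).trans (hC n k 0)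
  -- The `n`-th summand is rescaled so much that its derivatives of order `< n` are below `2⁻ⁿ`.
  let b : ℕ → ℝ := fun n => 2 ^ n * (1 + |a n| * ∑ k ∈ Finset.range n, C n k)
  have hS : ∀ n, 0 ≤ |a n| * ∑ k ∈ Finset.range n, C n k := fun n =>
    mul_nonneg (abs_nonneg _) (Finset.sum_nonneg fun k _ => hC0 n k)
  have hb1 : ∀ n, 1 ≤ b n := fun n =>
    one_le_mul_of_one_le_of_one_le (one_le_pow₀ one_le_two) (by linarith [hS n])
  have hb0 : ∀ n, 0 < b n := fun n => one_pos.trans_le (hb1 n)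
  let g : ℕ → ℕ → ℝ → ℝ := fun k n x =>
    a n / n.factorial * (b n ^ k / b n ^ n) * iteratedDeriv k (ρ n) (b n * x)
  have hg : ∀ k n x, HasDerivAt (g k n) (g (k + 1) n x) x := by
    intro k n x
    have h1 : HasDerivAt (fun y => b n * y) (b n) x := by
      simpa using (hasDerivAt_id x).const_mul (b n)
    have h2 := (((hρ n).hasDerivAt_iteratedDeriv k (b n * x)).comp x h1).const_mul
      (a n / n.factorial * (b n ^ k / b n ^ n))
    exact h2.congr_deriv (by simp only [g, pow_succ]; ring)
  have hgb : ∀ k n x, |g k n x| ≤ |a n| * (b n ^ k / b n ^ n) * C n k := by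
    intro k n x
    simp only [g, abs_mul, abs_div]
    have h1 : (1 : ℝ) ≤ n.factorial := by exact_mod_cast n.factorial_pos
    rw [abs_of_pos (pow_pos (hb0 n) _), abs_of_pos (pow_pos (hb0 n) _),
      abs_of_pos (by linarith : (0 : ℝ) < n.factorial)]
    have := hb0 n
    gcongr
    · exact div_le_self (abs_nonneg _) h1
    · exact hC n k _
  have hsum : ∀ k, Summable fun n => |a n| * (b n ^ k / b n ^ n) * C n k := by
    intro k
    refine Summable.of_norm_bounded_eventually (g := fun n => (1 / 2 : ℝ) ^ n)
      summable_geometric_two ?_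
    rw [Nat.cofinite_eq_atTop]
    filter_upwards [Filter.eventually_gt_atTop k] with n hn
    have hbn := hb0 n
    have h1 : b n ^ k / b n ^ n ≤ 1 / b n := by
      rw [div_le_div_iff₀ (pow_pos hbn _) hbn, one_mul, ← pow_succ]
      exact pow_le_pow_right₀ (hb1 n) hn
    have h2 : |a n| * C n k ≤ 1 + |a n| * ∑ k ∈ Finset.range n, C n k := by
      have : C n k ≤ ∑ k ∈ Finset.range n, C n k :=
        Finset.single_le_sum (fun i _ => hC0 n i) (Finset.mem_range.2 hn)
      nlinarith [abs_nonneg (a n)]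
    have h3 := hC0 n k
    rw [Real.norm_eq_abs, abs_of_nonneg (by positivity)]
    calc |a n| * (b n ^ k / b n ^ n) * C n k ≤ |a n| * (1 / b n) * C n k := by gcongr
      _ = (|a n| * C n k) / b n := by ring
      _ ≤ (1 + |a n| * ∑ k ∈ Finset.range n, C n k) / b n := by gcongr
      _ = (1 / 2) ^ n := by
        have : 1 + |a n| * ∑ k ∈ Finset.range n, C n k ≠ 0 := by linarith [hS n]
        simp only [b]
        field_simp
        rw [← mul_pow]
        norm_num
  have hG : ∀ k x, HasDerivAt (fun x => ∑' n, g k n x) (∑' n, g (k + 1) n x) x := fun k x =>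
    hasDerivAt_tsum (hsum (k + 1)) (hg k) (fun n y => hgb (k + 1) n y) (y₀ := 0)
      (Summable.of_norm_bounded (hsum k) fun n => hgb k n 0) x
  refine ⟨fun x => ∑' n, g 0 n x,
    contDiff_of_hasDerivAt_succ (G := fun k x => ∑' n, g k n x) hG, fun k => ?_⟩
  rw [iteratedDeriv_eq_of_hasDerivAt_succ (G := fun k x => ∑' n, g k n x) hG k]
  change ∑' n, g k n 0 = a k
  rw [tsum_eq_single k]
  · have h1 := (pow_pos (hb0 k) k).ne'
    have h2 : (k.factorial : ℝ) ≠ 0 := by exact_mod_cast k.factorial_ne_zero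
    simp only [g, mul_zero, hρ0, if_true]
    field_simp
  · intro n hn
    simp [g, hρ0, hn.symm]

/-- **Whitney's theorem on even functions**: a smooth even function is a smooth function of the
square of the coordinate. -/
theorem exists_smooth_eq_comp_sq {f : ℝ → ℝ} (hf : ContDiff ℝ ∞ f) (he : ∀ x, f (-x) = f x) :
    ∃ g : ℝ → ℝ, ContDiff ℝ ∞ g ∧ ∀ x, f x = g (x ^ 2) := by
  have step : ∀ f : {f : ℝ → ℝ // ContDiff ℝ ∞ f ∧ ∀ x, f (-x) = f x},
      ∃ g : {f : ℝ → ℝ // ContDiff ℝ ∞ f ∧ ∀ x, f (-x) = f x},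
        ∀ x, HasDerivAt f.1 (2 * x * g.1 x) x := by
    rintro ⟨f, hf, he⟩
    have hodd : ∀ x, deriv f (-x) = -deriv f x := by
      intro x
      have h1 : (fun x => f (-x)) = f := funext he
      have h2 := deriv_comp_neg f x
      rw [h1] at h2
      linarith
    have hd : ContDiff ℝ ∞ (deriv f) := (contDiff_infty_iff_deriv.1 hf).2
    obtain ⟨h, hh, hm, -⟩ := exists_smooth_eq_mul hd (by have := hodd 0; simp at this; linarith)
    refine ⟨⟨fun x => h x / 2, hh.div_const 2, fun x => ?_⟩, fun x => ?_⟩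
    · rcases eq_or_ne x 0 with rfl | hx
      · simp
      · have h1 := hodd x
        rw [hm, hm x] at h1
        have h2 : x * (h (-x) - h x) = 0 := by linarith
        have := (mul_eq_zero.1 h2).resolve_left hx
        simp only
        linarith
    · have h1 := ((contDiff_infty_iff_deriv.1 hf).1 x).hasDerivAt
      rw [hm] at h1
      exact h1.congr_deriv (by ring)
  choose D hD using step
  let F : ℕ → {f : ℝ → ℝ // ContDiff ℝ ∞ f ∧ ∀ x, f (-x) = f x} :=
    fun n => Nat.rec ⟨f, hf, he⟩ (fun _ => D) n
  have hF : ∀ k x, HasDerivAt (F k).1 (2 * x * (F (k + 1)).1 x) x := fun k x => hD (F k) x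
  obtain ⟨b, hb, hb0⟩ := exists_smooth_iteratedDeriv_zero_eq fun k => (F k).1 0
  -- `G k` is the `k`-th derivative of the function sought: on the positive side it is forced by
  -- `f`, on the negative side Borel's lemma supplies a function with the same jet at `0`.
  let G : ℕ → ℝ → ℝ := fun k u => if 0 ≤ u then (F k).1 (√u) else iteratedDeriv k b u
  have hGc : ∀ k, Continuous (G k) := fun k =>
    Continuous.if_le ((F k).2.1.continuous.comp Real.continuous_sqrt)
      (hb.smooth_iteratedDeriv k).continuous continuous_const continuous_id (by
        rintro x rfl
        simp [hb0])
  have hne : ∀ k x, x ≠ 0 → HasDerivAt (G k) (G (k + 1) x) x := by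
    intro k x hx
    rcases lt_or_gt_of_ne hx with hx | hx
    · have h1 := hb.hasDerivAt_iteratedDeriv k x
      have h2 : G (k + 1) x = iteratedDeriv (k + 1) b x := by simp [G, not_le.2 hx]
      rw [h2]
      refine h1.congr_of_eventuallyEq ?_
      filter_upwards [Iio_mem_nhds hx] with y hy
      simp [G, not_le.2 (Set.mem_Iio.1 hy)]
    · have h1 := (hF k (√x)).comp x (Real.hasDerivAt_sqrt hx.ne')
      have h2 : G (k + 1) x = (F (k + 1)).1 (√x) := by simp [G, hx.le]
      have h3 : √x ≠ 0 := (Real.sqrt_pos.2 hx).ne'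
      have h4 : 2 * √x * (F (k + 1)).1 (√x) * (1 / (2 * √x)) = (F (k + 1)).1 (√x) := by
        field_simp
      rw [h4] at h1
      rw [h2]
      refine h1.congr_of_eventuallyEq ?_
      filter_upwards [Ioi_mem_nhds hx] with y hy
      simp [G, (Set.mem_Ioi.1 hy).le]
  have hG : ∀ k x, HasDerivAt (G k) (G (k + 1) x) x := fun k x =>
    hasDerivAt_of_hasDerivAt_of_ne' (fun y hy => hne k y hy) (hGc k).continuousAt
      (hGc (k + 1)).continuousAt x
  refine ⟨G 0, contDiff_of_hasDerivAt_succ hG, fun x => ?_⟩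
  have h1 : G 0 (x ^ 2) = f |x| := by simp [G, F, sq_nonneg, Real.sqrt_sq_eq_abs]
  rw [h1]
  rcases abs_choice x with h | h <;> rw [h]
  exact (he x).symm

/-- The even and odd parts of a smooth function, as smooth functions of the square of the
coordinate. -/
theorem exists_smooth_even_odd {f : ℝ → ℝ} (hf : ContDiff ℝ ∞ f) :
    ∃ A B : ℝ → ℝ, ContDiff ℝ ∞ A ∧ ContDiff ℝ ∞ B ∧ ∀ x, f x = A (x ^ 2) + x * B (x ^ 2) := by
  have hfn : ContDiff ℝ ∞ fun x => f (-x) := hf.comp contDiff_neg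
  obtain ⟨A, hA, hA'⟩ := exists_smooth_eq_comp_sq (f := fun x => (f x + f (-x)) / 2)
    ((hf.add hfn).div_const 2) (fun x => by simp [add_comm])
  obtain ⟨h, hh, hm, -⟩ := exists_smooth_eq_mul (f := fun x => (f x - f (-x)) / 2)
    ((hf.sub hfn).div_const 2) (by simp)
  obtain ⟨B, hB, hB'⟩ := exists_smooth_eq_comp_sq hh (fun x => by
    rcases eq_or_ne x 0 with rfl | hx
    · simp
    · have h1 := hm x
      have h2 := hm (-x)
      rw [neg_neg] at h2
      have h3 : x * (h (-x) - h x) = 0 := by linarith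
      linarith [(mul_eq_zero.1 h3).resolve_left hx])
  refine ⟨A, B, hA, hB, fun x => ?_⟩
  rw [← hA', ← hB', ← hm]
  ring

/-- A function that is smooth near a point has the same germ there as a globally smooth
function. -/
theorem ContDiffOn.exists_smooth_eventuallyEq {E : Type*} [NormedAddCommGroup E] [NormedSpace ℝ E]
    {f : ℝ → E} {U : Set ℝ} {x : ℝ} (hf : ContDiffOn ℝ ∞ f U) (hU : U ∈ 𝓝 x) :
    ∃ F : ℝ → E, ContDiff ℝ ∞ F ∧ F =ᶠ[𝓝 x] f := by
  obtain ⟨ε, hε, hεU⟩ := Metric.mem_nhds_iff.1 hU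
  let χ : ContDiffBump x := ⟨ε / 4, ε / 2, by positivity, by linarith⟩
  refine ⟨fun y => χ y • f y, contDiff_iff_contDiffAt.2 fun y => ?_, ?_⟩
  · by_cases hy : y ∈ Metric.ball x ε
    · exact χ.contDiffAt.smul
        (hf.contDiffAt (Filter.mem_of_superset (Metric.isOpen_ball.mem_nhds hy) hεU))
    · have : (fun y => χ y • f y) =ᶠ[𝓝 y] fun _ => 0 := by
        have h1 : y ∉ tsupport χ := by
          rw [χ.tsupport_eq]
          intro h
          exact hy (Metric.closedBall_subset_ball (by simp [χ]; linarith) h)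
        filter_upwards [(isClosed_tsupport χ).isOpen_compl.mem_nhds h1] with z hz
        simp [image_eq_zero_of_notMem_tsupport hz]
      exact contDiffAt_const.congr_of_eventuallyEq this
  · filter_upwards [χ.eventuallyEq_one] with y hy
    simp [hy]

/-- Iterated Hadamard lemma. The derivatives of the quotient at `0` are positive multiples of those
of `f`. -/
theorem exists_smooth_eq_pow_mul (n : ℕ) {f : ℝ → ℝ} (hf : ContDiff ℝ ∞ f)
    (h0 : ∀ i < n, iteratedDeriv i f 0 = 0) :
    ∃ h : ℝ → ℝ, ContDiff ℝ ∞ h ∧ (∀ x, f x = x ^ n * h x) ∧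
      ∀ k, ∃ C > 0, iteratedDeriv k h 0 = C * iteratedDeriv (k + n) f 0 := by
  induction n with
  | zero => exact ⟨f, hf, by simp, fun k => ⟨1, one_pos, by simp⟩⟩
  | succ n ih =>
    obtain ⟨g, hg, hgm, hgd⟩ := ih fun i hi => h0 i (hi.trans n.lt_succ_self)
    obtain ⟨C, -, hC⟩ := hgd 0
    rw [iteratedDeriv_zero, zero_add, h0 n n.lt_succ_self, mul_zero] at hC
    obtain ⟨h, hh, hhm, hhd⟩ := exists_smooth_eq_mul hg hC
    refine ⟨h, hh, fun x => by rw [hgm, hhm]; ring, fun k => ?_⟩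
    obtain ⟨D, hD, hDe⟩ := hgd (k + 1)
    refine ⟨D / (k + 1), by positivity, ?_⟩
    rw [hhd, hDe, show k + 1 + n = k + (n + 1) by ring]
    ring

/-- The **inverse function theorem** for smooth maps, with an inverse that is smooth on the whole
of its domain. -/
theorem ContDiff.exists_openPartialHomeomorph {E F : Type*} [NormedAddCommGroup E]
    [NormedSpace ℝ E] [CompleteSpace E] [NormedAddCommGroup F] [NormedSpace ℝ F]
    {f : E → F} (hf : ContDiff ℝ ∞ f) {a : E} {f' : E ≃L[ℝ] F}
    (hf' : HasFDerivAt f (f' : E →L[ℝ] F) a) :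
    ∃ e : OpenPartialHomeomorph E F, ⇑e = f ∧ a ∈ e.source ∧ ContDiffOn ℝ ∞ e.symm e.target := by
  have hsm : (∞ : WithTop ℕ∞) ≠ 0 := by simp
  let e₀ := hf.contDiffAt.toOpenPartialHomeomorph f hf' hsm
  let O : Set E := fderiv ℝ f ⁻¹' Set.range ((↑) : (E ≃L[ℝ] F) → E →L[ℝ] F)
  have hO : IsOpen O := ContinuousLinearEquiv.isOpen.preimage (hf.continuous_fderiv hsm)
  refine ⟨e₀.restrOpen O hO, rfl, ⟨hf.contDiffAt.mem_toOpenPartialHomeomorph_source hf' hsm, ?_⟩, ?_⟩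
  · exact ⟨f', hf'.fderiv.symm⟩
  · intro y hy
    have hs : (e₀.restrOpen O hO).symm y ∈ (e₀.restrOpen O hO).source :=
      (e₀.restrOpen O hO).map_target hy
    obtain ⟨g, hg⟩ : (e₀.restrOpen O hO).symm y ∈ O := hs.2
    refine ((e₀.restrOpen O hO).contDiffAt_symm (f₀' := g) hy ?_ hf.contDiffAt).contDiffWithinAt
    rw [hg]
    exact ((hf.differentiable hsm) _).hasFDerivAt

/-- The local inverse of a smooth function of one variable, extended to a globally smooth
function. -/
theorem ContDiff.exists_smooth_local_inverse {r : ℝ → ℝ} (hr : ContDiff ℝ ∞ r) {x : ℝ}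
    (hx : deriv r x ≠ 0) :
    ∃ σ : ℝ → ℝ, ContDiff ℝ ∞ σ ∧ (∀ᶠ y in 𝓝 x, σ (r y) = y) ∧
      Filter.map r (𝓝 x) = 𝓝 (r x) := by
  have h1 := ((hr.differentiable (by simp)) x).hasDerivAt
  obtain ⟨e, he, hs, ht⟩ := hr.exists_openPartialHomeomorph
    (f' := ContinuousLinearEquiv.unitsEquivAut ℝ (Units.mk0 _ hx)) (a := x)
    (h1.hasFDerivAt.congr_fderiv (by ext; simp))
  have htx : r x ∈ e.target := he ▸ e.map_source hs
  obtain ⟨σ, hσ, hσe⟩ := ht.exists_smooth_eventuallyEq (e.open_target.mem_nhds htx)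
  refine ⟨σ, hσ, ?_, ?_⟩
  · filter_upwards [hr.continuous.continuousAt.eventually hσe, e.open_source.mem_nhds hs] with y h h'
    rw [h, ← he, e.left_inv h']
  · rw [← he]
    exact e.map_nhds_eq hs

namespace Minkowski

/-! ### Curve germs in hyperbolic space -/

/-- The functional `⟨v, ·⟩`. -/
noncomputable def innL (v : R41) : R41 →L[ℝ] ℝ :=
  LinearMap.toContinuousLinearMap
    { toFun := inn v
      map_add' := fun x y => by simp [inn]; ring
      map_smul' := fun c x => by simp [inn]; ring }

@[simp]
theorem innL_apply (v x : R41) : innL v x = inn v x := rfl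

theorem inn_comm (x y : R41) : inn x y = inn y x := by simp [inn]; ring

theorem hasDerivAt_inn {f g : ℝ → R41} {f' g' : R41} {s : ℝ} (hf : HasDerivAt f f' s)
    (hg : HasDerivAt g g' s) : HasDerivAt (fun s => inn (f s) (g s)) (inn f' (g s) + inn (f s) g') s := by
  have hf := hasDerivAt_pi.1 hf
  have hg := hasDerivAt_pi.1 hg
  exact (((((hf 0).mul (hg 0)).neg.add ((hf 1).mul (hg 1))).add ((hf 2).mul (hg 2))).add
    ((hf 3).mul (hg 3))).congr_deriv (by simp only [inn]; ring)

theorem contDiffOn_inn {E : Type*} [NormedAddCommGroup E] [NormedSpace ℝ E] {n : WithTop ℕ∞}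
    {f g : E → R41} {U : Set E} (hf : ContDiffOn ℝ n f U) (hg : ContDiffOn ℝ n g U) :
    ContDiffOn ℝ n (fun x => inn (f x) (g x)) U := by
  have hf := contDiffOn_pi.1 hf
  have hg := contDiffOn_pi.1 hg
  exact ((((hf 0).mul (hg 0)).neg.add ((hf 1).mul (hg 1))).add ((hf 2).mul (hg 2))).add
    ((hf 3).mul (hg 3))

/-- A smooth map to `ℝ³` whose derivative is injective on the tangent space of hyperbolic space
at `v₀` restricts to a chart of hyperbolic space near `v₀`. -/
theorem exists_chart {Φ : R41 → R3} (hΦ : ContDiff ℝ ∞ Φ) {v₀ : R41}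
    (hinj : ∀ x, HasDerivAt (fun τ : ℝ => Φ (v₀ + τ • x)) 0 0 → inn v₀ x = 0 → x = 0) :
    ∃ (Ω : Set R41) (W : Set R3) (Ψ : R3 → R41), v₀ ∈ Ω ∧
      IsOpen Ω ∧ IsOpen W ∧ ContDiffOn ℝ ∞ Ψ W ∧
      Set.MapsTo Φ (H3 ∩ Ω) W ∧ Set.MapsTo Ψ W (H3 ∩ Ω) ∧ Set.InvOn Ψ Φ (H3 ∩ Ω) W := by
  -- The map `x ↦ (Φ x, ⟨x, x⟩ + 1)` is a local diffeomorphism that straightens hyperbolic space.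
  let F : R41 → R3 × ℝ := fun x => (Φ x, inn x x + 1)
  have hF : ContDiff ℝ ∞ F := hΦ.prodMk
    ((contDiffOn_univ.1 (contDiffOn_inn contDiffOn_id contDiffOn_id)).add contDiff_const)
  have hd : HasFDerivAt F (fderiv ℝ F v₀) v₀ := (hF.differentiable (by simp) v₀).hasFDerivAt
  have hker : Function.Injective (fderiv ℝ F v₀) := by
    refine (injective_iff_map_eq_zero _).2 fun x hx => ?_
    have hl : HasDerivAt (fun τ : ℝ => v₀ + τ • x) x 0 := by
      simpa using ((hasDerivAt_id (0 : ℝ)).smul_const x).const_add v₀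
    have h1 : HasDerivAt (fun τ : ℝ => F (v₀ + τ • x)) 0 0 := by
      have hd' : HasFDerivAt F (fderiv ℝ F v₀) (v₀ + (0 : ℝ) • x) := by simpa using hd
      have := hd'.comp_hasDerivAt (0 : ℝ) hl
      rwa [hx] at this
    refine hinj x ((ContinuousLinearMap.fst ℝ R3 ℝ).hasFDerivAt.comp_hasDerivAt (0 : ℝ) h1) ?_
    have h2 := ((ContinuousLinearMap.snd ℝ R3 ℝ).hasFDerivAt.comp_hasDerivAt (0 : ℝ) h1).unique
      ((hasDerivAt_inn hl hl).add_const 1)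
    rw [inn_comm x] at h2
    simp only [map_zero, zero_smul, add_zero] at h2
    linarith
  have hfin : Module.finrank ℝ R41 = Module.finrank ℝ (R3 × ℝ) := by simp
  obtain ⟨e, he, hs, ht⟩ := hF.exists_openPartialHomeomorph (a := v₀)
    (f' := (LinearEquiv.ofInjectiveOfFinrankEq (fderiv ℝ F v₀ : R41 →ₗ[ℝ] R3 × ℝ) hker
      hfin).toContinuousLinearEquiv) (hd.congr_fderiv (by ext <;> rfl))
  have hFN : ∀ x ∈ H3, F x = (Φ x, 0) := fun x hx => by
    simp [F, show inn x x = -1 from hx]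
  have hcont : ContDiff ℝ ∞ fun y : R3 => (y, (0 : ℝ)) := contDiff_id.prodMk contDiff_const
  refine ⟨e.source, {y | (y, (0 : ℝ)) ∈ e.target}, fun y => e.symm (y, 0), hs, e.open_source,
    e.open_target.preimage hcont.continuous, ht.comp hcont.contDiffOn fun y hy => hy, ?_, ?_, ?_, ?_⟩
  · rintro x ⟨hx, hxs⟩
    change (Φ x, (0 : ℝ)) ∈ e.target
    rw [← hFN x hx, ← he]
    exact e.map_source hxs
  · intro y hy
    refine ⟨?_, e.map_target hy⟩
    have h1 := e.right_inv hy
    rw [he] at h1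
    have h2 : inn (e.symm (y, 0)) (e.symm (y, 0)) + 1 = 0 := congrArg Prod.snd h1
    exact (by linarith : inn (e.symm (y, 0)) (e.symm (y, 0)) = -1)
  · rintro x ⟨hx, hxs⟩
    simp only
    rw [← hFN x hx, ← he, e.left_inv hxs]
  · intro y hy
    have h1 := e.right_inv hy
    rw [he] at h1
    exact congrArg Prod.fst h1

/-- A chart of hyperbolic space that takes the curve `c` to `P ∘ r`, with `r` a homeomorphism germ
and `P` a topological embedding germ, identifies the germ of the image of `c` with that of the
range of `P`. -/
theorem imageGermDiffeomorphic_range {Φ : R41 → R3} (hΦ : ContDiff ℝ ∞ Φ) {c : ℝ → R41} {s₀ : ℝ}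
    (hc : ContinuousAt c s₀) (hN : ∀ᶠ s in 𝓝 s₀, c s ∈ H3)
    (hinj : ∀ x, HasDerivAt (fun τ : ℝ => Φ (c s₀ + τ • x)) 0 0 → inn (c s₀) x = 0 → x = 0)
    {P : ℝ → R3} {r : ℝ → ℝ} (hP0 : P 0 = 0) (hP : Filter.comap P (𝓝 0) ≤ 𝓝 0)
    (hr0 : r s₀ = 0) (hr : Filter.map r (𝓝 s₀) = 𝓝 0)
    (hPr : ∀ᶠ s in 𝓝 s₀, Φ (c s) = P (r s)) :
    ImageGermDiffeomorphic H3 c s₀ (Set.range P) 0 := by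
  obtain ⟨Ω, W, Ψ, hvΩ, hΩ, hW, hΨ, h1, h2, h3⟩ := exists_chart hΦ hinj
  refine ⟨Ω, W, Φ, Ψ, hΩ, hW, hΦ.contDiffOn, hΨ, h1, h2, h3, ?_,
    {s | (c s ∈ H3 ∧ c s ∈ Ω) ∧ Φ (c s) = P (r s)},
    (hN.and (hc.eventually (hΩ.mem_nhds hvΩ))).and hPr, fun s hs => hs.1, fun J hJ hJJ => ?_⟩
  · rw [hPr.self_of_nhds, hr0, hP0]
  · have hrJ : r '' J ∈ 𝓝 (0 : ℝ) := hr ▸ Filter.image_mem_map hJ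
    obtain ⟨t, ht, htJ⟩ := Filter.mem_comap.1 (hP hrJ)
    filter_upwards [ht] with y hy
    constructor
    · rintro ⟨_, ⟨s, hs, rfl⟩, rfl⟩
      exact ⟨r s, (hJJ hs).2.symm⟩
    · rintro ⟨a, rfl⟩
      obtain ⟨s, hs, rfl⟩ := htJ hy
      exact ⟨_, ⟨s, hs, rfl⟩, (hJJ hs).2⟩

/-- The map to `ℝ³` obtained from three linear coordinates by a triangular change of variables. -/
noncomputable def triangularMap (l₁ l₂ l₃ : R41 →L[ℝ] ℝ) (p κ q w : ℝ → ℝ) (x : R41) : R3 :=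
  ![l₁ x, (l₂ x - p (l₁ x)) * κ (l₁ x),
    l₃ x - q (l₁ x) - (l₂ x - p (l₁ x)) * κ (l₁ x) * w (l₁ x)]

theorem contDiff_triangularMap (l₁ l₂ l₃ : R41 →L[ℝ] ℝ) {p κ q w : ℝ → ℝ} (hp : ContDiff ℝ ∞ p)
    (hκ : ContDiff ℝ ∞ κ) (hq : ContDiff ℝ ∞ q) (hw : ContDiff ℝ ∞ w) :
    ContDiff ℝ ∞ (triangularMap l₁ l₂ l₃ p κ q w) := by
  have h1 := l₁.contDiff (n := ∞)
  have h2 := l₂.contDiff (n := ∞)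
  have h3 := l₃.contDiff (n := ∞)
  refine contDiff_pi.2 fun i => ?_
  fin_cases i
  · exact h1
  · exact (h2.sub (hp.comp h1)).mul (hκ.comp h1)
  · exact (h3.sub (hq.comp h1)).sub (((h2.sub (hp.comp h1)).mul (hκ.comp h1)).mul (hw.comp h1))

/-- If `l₁, l₂, l₃` are coordinates on the tangent space of hyperbolic space at `v`, the derivative of
the triangular map is injective there: `l₁`, `l₂` and `l₃` vanish on its kernel, one after the
other. -/
theorem triangularMap_injective_deriv {l₁ l₂ l₃ : R41 →L[ℝ] ℝ} {p κ q w : ℝ → ℝ} (hκ : κ 0 ≠ 0)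
    {v : R41} (hv₁ : l₁ v = 0) (hv₂ : l₂ v = 0) (hv₃ : l₃ v = 0)
    (hl : ∀ x, l₁ x = 0 → l₂ x = 0 → l₃ x = 0 → inn v x = 0 → x = 0) (x : R41)
    (hx : HasDerivAt (fun τ : ℝ => triangularMap l₁ l₂ l₃ p κ q w (v + τ • x)) 0 0)
    (hvx : inn v x = 0) : x = 0 := by
  have hx := hasDerivAt_pi.1 hx
  have hlin : ∀ a b : ℝ, HasDerivAt (fun τ : ℝ => τ * a + b) a 0 := fun a b => by
    simpa using ((hasDerivAt_id (0 : ℝ)).mul_const a).add_const b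
  have h1 : l₁ x = 0 := by
    have h := hx 0
    simp only [triangularMap, map_add, map_smul, hv₁, smul_eq_mul] at h
    exact ((hlin (l₁ x) 0).congr_of_eventuallyEq (Filter.Eventually.of_forall fun τ => by
      simp)).unique h
  have h2 : l₂ x = 0 := by
    have h := hx 1
    simp only [triangularMap, map_add, map_smul, hv₁, hv₂, h1, smul_eq_mul] at h
    have := ((hlin (l₂ x * κ 0) (-p 0 * κ 0)).congr_of_eventuallyEq
      (Filter.Eventually.of_forall fun τ => by simp; ring)).unique h
    exact (mul_eq_zero.1 this).resolve_right hκ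
  have h3 : l₃ x = 0 := by
    have h := hx 2
    simp only [triangularMap, map_add, map_smul, hv₁, hv₂, hv₃, h1, h2, smul_eq_mul] at h
    exact ((hlin (l₃ x) (-q 0 + p 0 * κ 0 * w 0)).congr_of_eventuallyEq
      (Filter.Eventually.of_forall fun τ => by simp; ring)).unique h
  exact hl x h1 h2 h3 hvx

/-- A regular curve in hyperbolic space is locally diffeomorphic to a line. -/
theorem imageGermDiffeomorphic_lineModel {c : ℝ → R41} {s₀ : ℝ} {U : Set ℝ} (hU : U ∈ 𝓝 s₀)
    (hc : ContDiffOn ℝ ∞ c U) (hN : ∀ᶠ s in 𝓝 s₀, c s ∈ H3) {l₁ l₂ l₃ : R41 →L[ℝ] ℝ}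
    (hv₁ : l₁ (c s₀) = 0) (hv₂ : l₂ (c s₀) = 0) (hv₃ : l₃ (c s₀) = 0)
    (hl : ∀ x, l₁ x = 0 → l₂ x = 0 → l₃ x = 0 → inn (c s₀) x = 0 → x = 0)
    (h₁ : deriv (fun s => l₁ (c s)) s₀ ≠ 0) :
    ImageGermDiffeomorphic H3 c s₀ lineModel 0 := by
  obtain ⟨V, hV, hVc⟩ := hc.exists_smooth_eventuallyEq hU
  have hr : ContDiff ℝ ∞ fun s => l₁ (V s) := l₁.contDiff.comp hV
  have hd : deriv (fun s => l₁ (V s)) s₀ ≠ 0 := by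
    have h := (hVc.fun_comp l₁).deriv_eq
    exact fun h0 => h₁ (h.symm.trans h0)
  obtain ⟨σ, hσ, hσr, hmap⟩ := hr.exists_smooth_local_inverse hd
  have hr0 : l₁ (V s₀) = 0 := by rw [hVc.self_of_nhds, hv₁]
  rw [hr0] at hmap
  refine imageGermDiffeomorphic_range (r := fun s => l₁ (V s))
    (contDiff_triangularMap l₁ l₂ l₃ (l₂.contDiff.comp (hV.comp hσ)) contDiff_const
      (l₃.contDiff.comp (hV.comp hσ)) contDiff_const (κ := fun _ => 1) (w := fun _ => 0))
    (hc.contDiffAt hU).continuousAt hN (triangularMap_injective_deriv one_ne_zero hv₁ hv₂ hv₃ hl)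
    (by ext i; fin_cases i <;> rfl) ?_ hr0 hmap ?_
  · have h1 : Filter.Tendsto (fun y : R3 => y 0) (𝓝 0) (𝓝 0) :=
      (continuous_apply (0 : Fin 3)).tendsto' 0 0 rfl
    have h2 := h1.comp (Filter.tendsto_comap (f := fun r : ℝ => (![r, 0, 0] : R3)))
    exact h2
  · filter_upwards [hσr, hVc] with s h h'
    rw [h'] at h
    simp [triangularMap, h, h']

/-- Coordinates adapted to a curve germ with components of orders `2`, `3` and at least `2`: the
first is the square of a parameter `r`, and triangular changes of variables, with coefficients that
are smooth functions of the first component, turn the others into `r³` and `r⁴`. -/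
theorem exists_cusp_coordinates {f₁ f₂ f₃ : ℝ → ℝ} (hf₁ : ContDiff ℝ ∞ f₁) (hf₂ : ContDiff ℝ ∞ f₂)
    (hf₃ : ContDiff ℝ ∞ f₃) (h₁ : ∀ i < 2, iteratedDeriv i f₁ 0 = 0) (h₁' : 0 < iteratedDeriv 2 f₁ 0)
    (h₂ : ∀ i < 3, iteratedDeriv i f₂ 0 = 0) (h₂' : iteratedDeriv 3 f₂ 0 ≠ 0)
    (h₃ : ∀ i < 2, iteratedDeriv i f₃ 0 = 0) :
    ∃ r p κ q w : ℝ → ℝ, ContDiff ℝ ∞ p ∧ ContDiff ℝ ∞ κ ∧ ContDiff ℝ ∞ q ∧ ContDiff ℝ ∞ w ∧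
      κ 0 ≠ 0 ∧ r 0 = 0 ∧ Filter.map r (𝓝 0) = 𝓝 0 ∧
      ∀ᶠ x in 𝓝 0, f₁ x = r x ^ 2 ∧ (f₂ x - p (f₁ x)) * κ (f₁ x) = r x ^ 3 ∧
        f₃ x - q (f₁ x) - r x ^ 3 * w (f₁ x) = r x ^ 4 := by
  obtain ⟨g₁, hg₁, hm₁, hd₁⟩ := exists_smooth_eq_pow_mul 2 hf₁ h₁
  obtain ⟨g₂, hg₂, hm₂, hd₂⟩ := exists_smooth_eq_pow_mul 3 hf₂ h₂
  obtain ⟨g₃, hg₃, hm₃, -⟩ := exists_smooth_eq_pow_mul 2 hf₃ h₃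
  have hg₁0 : 0 < g₁ 0 := by
    obtain ⟨C, hC, h⟩ := hd₁ 0
    rw [iteratedDeriv_zero, zero_add] at h
    rw [h]
    positivity
  have hg₂0 : g₂ 0 ≠ 0 := by
    obtain ⟨C, hC, h⟩ := hd₂ 0
    rw [iteratedDeriv_zero, zero_add] at h
    rw [h]
    exact mul_ne_zero hC.ne' h₂'
  have hpos : IsOpen {x | 0 < g₁ x} := isOpen_lt continuous_const hg₁.continuous
  obtain ⟨e, he, hee⟩ : ∃ e : ℝ → ℝ, ContDiff ℝ ∞ e ∧ e =ᶠ[𝓝 0] fun x => (√(g₁ x))⁻¹ := by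
    refine ContDiffOn.exists_smooth_eventuallyEq (U := {x | 0 < g₁ x}) ?_ (hpos.mem_nhds hg₁0)
    exact (hg₁.contDiffOn.sqrt fun x hx => ne_of_gt hx).inv
      fun x hx => (Real.sqrt_pos.2 hx).ne'
  have hee' : ∀ᶠ x in 𝓝 (0 : ℝ), e x ^ 2 * g₁ x = 1 := by
    filter_upwards [hee, hpos.mem_nhds hg₁0] with x h h'
    have h' : 0 < g₁ x := h'
    rw [h, inv_pow, Real.sq_sqrt h'.le, inv_mul_cancel₀ h'.ne']
  -- The parameter `r x = x √(g₁ x)`, for which `f₁ = r²` and `x = r e`.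
  let r : ℝ → ℝ := fun x => x * (e x * g₁ x)
  have hr : ContDiff ℝ ∞ r := contDiff_id.mul (he.mul hg₁)
  have hr0 : r 0 = 0 := by simp [r]
  have he0 : e 0 ≠ 0 := fun h => by simpa [h] using hee'.self_of_nhds
  have hrd : deriv r 0 ≠ 0 := by
    have h1 : HasDerivAt r _ 0 := (hasDerivAt_id (0 : ℝ)).mul
      (((he.mul hg₁).differentiable (by simp) 0).hasDerivAt)
    rw [h1.deriv]
    simp [he0, hg₁0.ne']
  obtain ⟨σ, hσ, hσr, hmap⟩ := hr.exists_smooth_local_inverse hrd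
  rw [hr0] at hmap
  have hσ0 : σ 0 = 0 := by simpa [hr0] using hσr.self_of_nhds
  obtain ⟨A, B, hA, hB, hAB⟩ := exists_smooth_even_odd
    (f := fun a => e (σ a) ^ 3 * g₂ (σ a)) (((he.comp hσ).pow 3).mul (hg₂.comp hσ))
  obtain ⟨A', B', hA', hB', hAB'⟩ := exists_smooth_even_odd
    (f := fun a => e (σ a) ^ 2 * g₃ (σ a)) (((he.comp hσ).pow 2).mul (hg₃.comp hσ))
  have hA0 : A 0 ≠ 0 := by
    have h := hAB 0
    simp only [hσ0, ne_eq, OfNat.ofNat_ne_zero, not_false_eq_true, zero_pow, zero_mul, add_zero] at h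
    rw [← h]
    exact mul_ne_zero (pow_ne_zero _ he0) hg₂0
  have hAne : {u | A u ≠ 0} ∈ 𝓝 (0 : ℝ) := (isOpen_ne_fun hA.continuous continuous_const).mem_nhds hA0
  obtain ⟨κ, hκ, hκA⟩ := (hA.contDiffOn.inv fun u hu => hu :
    ContDiffOn ℝ ∞ (fun u => (A u)⁻¹) {u | A u ≠ 0}).exists_smooth_eventuallyEq hAne
  refine ⟨r, fun u => u ^ 2 * B u, κ, fun u => u * A' u - u ^ 2, B', (contDiff_id.pow 2).mul hB, hκ,
    (contDiff_id.mul hA').sub (contDiff_id.pow 2), hB', ?_, hr0, hmap, ?_⟩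
  · rw [hκA.self_of_nhds]
    exact inv_ne_zero hA0
  · have hf₁0 : f₁ 0 = 0 := by simp [hm₁]
    have ht : Filter.Tendsto f₁ (𝓝 0) (𝓝 0) := hf₁.continuous.tendsto' 0 0 hf₁0
    filter_upwards [hee', hσr, ht.eventually hκA, ht.eventually hAne] with x h1 h2 h3 h4
    have hx : x = r x * e x := by
      simp only [r]
      linear_combination (-x) * h1
    have hf : f₁ x = r x ^ 2 := by
      rw [hm₁]
      simp only [r]
      linear_combination (-(x ^ 2 * g₁ x)) * h1
    have hf2 : f₂ x = r x ^ 3 * (A (r x ^ 2) + r x * B (r x ^ 2)) := by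
      rw [← hAB, h2, hm₂]
      nth_rw 1 [hx]
      ring
    have hf3 : f₃ x = r x ^ 2 * (A' (r x ^ 2) + r x * B' (r x ^ 2)) := by
      rw [← hAB', h2, hm₃]
      nth_rw 1 [hx]
      ring
    refine ⟨hf, ?_, ?_⟩
    · rw [h3, Pi.inv_apply]
      rw [hf] at h4 ⊢
      have h4 : A (r x ^ 2) ≠ 0 := h4
      rw [hf2]
      field_simp
      ring
    · rw [hf3, hf]
      ring

/-- A curve in hyperbolic space with components of orders `2` and `3` is locally diffeomorphic to
the `(2,3,4)`-cusp. No condition on a third component is needed: the cusp lies on the smooth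
surface `z = x²`, so that its germ is that of the planar cusp `(r², r³, 0)`. -/
theorem imageGermDiffeomorphic_cusp234 {c : ℝ → R41} {s₀ : ℝ} {U : Set ℝ} (hU : U ∈ 𝓝 s₀)
    (hc : ContDiffOn ℝ ∞ c U) (hN : ∀ᶠ s in 𝓝 s₀, c s ∈ H3) {l₁ l₂ l₃ : R41 →L[ℝ] ℝ}
    (hl : ∀ x, l₁ x = 0 → l₂ x = 0 → l₃ x = 0 → inn (c s₀) x = 0 → x = 0)
    (h₁ : ∀ i < 2, iteratedDeriv i (fun s => l₁ (c s)) s₀ = 0)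
    (h₁' : iteratedDeriv 2 (fun s => l₁ (c s)) s₀ ≠ 0)
    (h₂ : ∀ i < 3, iteratedDeriv i (fun s => l₂ (c s)) s₀ = 0)
    (h₂' : iteratedDeriv 3 (fun s => l₂ (c s)) s₀ ≠ 0)
    (h₃ : ∀ i < 2, iteratedDeriv i (fun s => l₃ (c s)) s₀ = 0) :
    ImageGermDiffeomorphic H3 c s₀ cusp234 0 := by
  wlog hpos : 0 < iteratedDeriv 2 (fun s => l₁ (c s)) s₀ generalizing l₁
  · have hneg : ∀ i, iteratedDeriv i (fun s => (-l₁) (c s)) s₀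
        = -iteratedDeriv i (fun s => l₁ (c s)) s₀ := fun i =>
      iteratedDeriv_fun_neg i (fun s => l₁ (c s)) s₀
    refine this (l₁ := -l₁) (fun x hx => hl x (by simpa using hx)) (fun i hi => ?_) ?_ ?_
    · rw [hneg, h₁ i hi, neg_zero]
    · rw [hneg]
      exact neg_ne_zero.2 h₁'
    · rw [hneg]
      exact neg_pos.2 (lt_of_le_of_ne (not_lt.1 hpos) h₁')
  obtain ⟨V, hV, hVc⟩ := hc.exists_smooth_eventuallyEq hU
  have hi : ∀ (l : R41 →L[ℝ] ℝ) (i : ℕ), iteratedDeriv i (fun x => l (V (s₀ + x))) 0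
      = iteratedDeriv i (fun s => l (c s)) s₀ := fun l i => by
    have h1 := congrFun (iteratedDeriv_comp_const_add i (fun s => l (V s)) s₀) 0
    rw [h1, add_zero]
    exact (hVc.fun_comp l).iteratedDeriv_eq i
  have hs : ∀ l : R41 →L[ℝ] ℝ, ContDiff ℝ ∞ fun x => l (V (s₀ + x)) := fun l =>
    l.contDiff.comp (hV.comp (contDiff_const.add contDiff_id))
  obtain ⟨r, p, κ, q, w, hp, hκ, hq, hw, hκ0, hr0, hmap, hev⟩ := exists_cusp_coordinates (hs l₁)
    (hs l₂) (hs l₃) (fun i h => (hi l₁ i).trans (h₁ i h)) (by rwa [hi l₁])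
    (fun i h => (hi l₂ i).trans (h₂ i h)) (by rwa [hi l₂]) (fun i h => (hi l₃ i).trans (h₃ i h))
  have hshift : Filter.map (fun s => s - s₀) (𝓝 s₀) = 𝓝 0 := by
    have h := (Homeomorph.subRight s₀).map_nhds_eq s₀
    simpa only [Homeomorph.coe_subRight, sub_self] using h
  have htend : Filter.Tendsto (fun s => s - s₀) (𝓝 s₀) (𝓝 0) := hshift.le
  refine imageGermDiffeomorphic_range (r := fun s => r (s - s₀))
    (contDiff_triangularMap l₁ l₂ l₃ hp hκ hq hw) (hc.contDiffAt hU).continuousAt hN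
    (triangularMap_injective_deriv hκ0 ?_ ?_ ?_ hl) (by ext i; fin_cases i <;> simp) ?_
    (by simp [hr0]) ?_ ?_
  · exact h₁ 0 two_pos
  · exact h₂ 0 three_pos
  · exact h₃ 0 two_pos
  · have h1 : Filter.Tendsto (fun y : R3 => √|y 0|) (𝓝 0) (𝓝 0) :=
      (by fun_prop : Continuous fun y : R3 => √|y 0|).tendsto' 0 0 (by simp)
    have h2 := h1.comp (Filter.tendsto_comap (f := fun r : ℝ => (![r ^ 2, r ^ 3, r ^ 4] : R3)))
    have h3 : (fun y : R3 => √|y 0|) ∘ (fun r : ℝ => (![r ^ 2, r ^ 3, r ^ 4] : R3)) = fun r => |r| := by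
      ext r
      simp [Real.sqrt_sq_eq_abs]
    rw [h3] at h2
    exact tendsto_zero_iff_abs_tendsto_zero _ |>.2 h2
  · rw [← hmap, ← hshift, Filter.map_map]
    rfl
  · filter_upwards [htend.eventually hev, hVc] with s ⟨h1, h2, h3⟩ h
    simp only [add_sub_cancel, h] at h1 h2 h3
    ext i
    fin_cases i
    · exact h1
    · exact h2
    · rw [← h2] at h3
      exact h3.trans rfl

end Minkowski

theorem ContDiffOn.iteratedDeriv_of_isOpen {E : Type*} [NormedAddCommGroup E] [NormedSpace ℝ E]
    {f : ℝ → E} {J : Set ℝ} (hf : ContDiffOn ℝ ∞ f J) (hJ : IsOpen J) (k : ℕ) :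
    ContDiffOn ℝ ∞ (iteratedDeriv k f) J := by
  induction k with
  | zero => simpa using hf
  | succ k ih =>
    rw [iteratedDeriv_succ]
    exact ih.deriv_of_isOpen hJ (by simp)

theorem ContDiffOn.hasDerivAt_of_isOpen {E : Type*} [NormedAddCommGroup E] [NormedSpace ℝ E]
    {f : ℝ → E} {J : Set ℝ} (hf : ContDiffOn ℝ ∞ f J) (hJ : IsOpen J) {s : ℝ} (hs : s ∈ J) :
    HasDerivAt f (deriv f s) s :=
  ((hf.contDiffAt (hJ.mem_nhds hs)).differentiableAt (by simp)).hasDerivAt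

namespace Minkowski

/-! ### Minkowski algebra and the unit normal -/

theorem inn_add_left (x y z : R41) : inn (x + y) z = inn x z + inn y z := by simp [inn]; ring

theorem inn_smul_left (a : ℝ) (x y : R41) : inn (a • x) y = a * inn x y := by simp [inn]; ring

theorem inn_add_right (x y z : R41) : inn x (y + z) = inn x y + inn x z := by simp [inn]; ring

theorem inn_smul_right (a : ℝ) (x y : R41) : inn x (a • y) = a * inn x y := by simp [inn]; ring

theorem inn_neg_left (x y : R41) : inn (-x) y = -inn x y := by simp [inn]; ring

theorem inn_zero_left (x : R41) : inn 0 x = 0 := by simp [inn]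

theorem inn_zero_right (x : R41) : inn x 0 = 0 := by simp [inn]

theorem wedge_eq (x y z : R41) : wedge x y z = ![
    -(x 1 * (y 2 * z 3 - y 3 * z 2) - x 2 * (y 1 * z 3 - y 3 * z 1) + x 3 * (y 1 * z 2 - y 2 * z 1)),
    -(x 0 * (y 2 * z 3 - y 3 * z 2) - x 2 * (y 0 * z 3 - y 3 * z 0) + x 3 * (y 0 * z 2 - y 2 * z 0)),
    x 0 * (y 1 * z 3 - y 3 * z 1) - x 1 * (y 0 * z 3 - y 3 * z 0) + x 3 * (y 0 * z 1 - y 1 * z 0),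
    -(x 0 * (y 1 * z 2 - y 2 * z 1) - x 1 * (y 0 * z 2 - y 2 * z 0)
      + x 2 * (y 0 * z 1 - y 1 * z 0))] := by
  ext i
  fin_cases i <;>
    simp [wedge, Matrix.det_succ_row_zero, Fin.sum_univ_succ, Fin.succAbove, Pi.single_apply] <;>
    ring

theorem inn_wedge_first (x y z : R41) : inn (wedge x y z) x = 0 := by
  rw [wedge_eq]
  simp [inn]
  ring

theorem inn_wedge_second (x y z : R41) : inn (wedge x y z) y = 0 := by
  rw [wedge_eq]
  simp [inn]
  ring

theorem inn_wedge_third (x y z : R41) : inn (wedge x y z) z = 0 := by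
  rw [wedge_eq]
  simp [inn]
  ring

/-- Up to sign, the pseudo-scalar square of the vector product is the Gram determinant. -/
theorem inn_wedge_self (x y z : R41) : inn (wedge x y z) (wedge x y z) =
    -(inn x x * (inn y y * inn z z - inn y z ^ 2) - inn x y * (inn x y * inn z z - inn y z * inn x z)
      + inn x z * (inn x y * inn y z - inn y y * inn x z)) := by
  rw [wedge_eq]
  simp [inn]
  ring

theorem contDiffOn_wedge {E : Type*} [NormedAddCommGroup E] [NormedSpace ℝ E] {n : WithTop ℕ∞}
    {f g h : E → R41} {U : Set E} (hf : ContDiffOn ℝ n f U) (hg : ContDiffOn ℝ n g U)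
    (hh : ContDiffOn ℝ n h U) : ContDiffOn ℝ n (fun x => wedge (f x) (g x) (h x)) U := by
  have hf := contDiffOn_pi.1 hf
  have hg := contDiffOn_pi.1 hg
  have hh := contDiffOn_pi.1 hh
  simp only [wedge_eq]
  refine contDiffOn_pi.2 fun i => ?_
  fin_cases i <;> simp <;> fun_prop

theorem contDiffOn_pnorm {E : Type*} [NormedAddCommGroup E] [NormedSpace ℝ E]
    {f : E → R41} {U : Set E} (hf : ContDiffOn ℝ ∞ f U) (h0 : ∀ x ∈ U, inn (f x) (f x) ≠ 0) :
    ContDiffOn ℝ ∞ (fun x => pnorm (f x)) U := by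
  intro x hx
  have h1 := contDiffOn_inn hf hf x hx
  have h2 : ContDiffWithinAt ℝ ∞ (fun x => |inn (f x) (f x)|) U x :=
    ContDiffAt.comp_contDiffWithinAt (g := fun y : ℝ => |y|) x (contDiffAt_abs (h0 x hx)) h1
  exact h2.sqrt (abs_ne_zero.2 (h0 x hx))

theorem pnorm_sq (x : R41) : pnorm x ^ 2 = |inn x x| := Real.sq_sqrt (abs_nonneg _)

/-- The orthogonal complement of a unit timelike vector contains no timelike vector. -/
theorem inn_self_nonneg_of_orthogonal {n q : R41} (hn : inn n n = -1) (hq : inn n q = 0) :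
    0 ≤ inn q q := by
  simp only [inn] at *
  have h1 : n 0 ^ 2 = 1 + (n 1 ^ 2 + n 2 ^ 2 + n 3 ^ 2) := by linear_combination -hn
  have h2 : n 0 * q 0 = n 1 * q 1 + n 2 * q 2 + n 3 * q 3 := by linear_combination -hq
  have h3 : (n 1 * q 1 + n 2 * q 2 + n 3 * q 3) ^ 2
      ≤ (n 1 ^ 2 + n 2 ^ 2 + n 3 ^ 2) * (q 1 ^ 2 + q 2 ^ 2 + q 3 ^ 2) := by
    nlinarith [sq_nonneg (n 1 * q 2 - n 2 * q 1), sq_nonneg (n 1 * q 3 - n 3 * q 1),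
      sq_nonneg (n 2 * q 3 - n 3 * q 2)]
  have h4 : n 0 ^ 2 * q 0 ^ 2 ≤ n 0 ^ 2 * (q 1 ^ 2 + q 2 ^ 2 + q 3 ^ 2) := by
    calc n 0 ^ 2 * q 0 ^ 2 = (n 0 * q 0) ^ 2 := by ring
      _ ≤ (n 1 ^ 2 + n 2 ^ 2 + n 3 ^ 2) * (q 1 ^ 2 + q 2 ^ 2 + q 3 ^ 2) := h2 ▸ h3
      _ ≤ n 0 ^ 2 * (q 1 ^ 2 + q 2 ^ 2 + q 3 ^ 2) := by
        gcongr
        linarith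
  have h5 : 0 < n 0 ^ 2 := by rw [h1]; positivity
  have := le_of_mul_le_mul_left h4 h5
  linarith

/-- A normal vector of a 3-dimensional space that contains only spacelike vectors besides `0` is not
spacelike: otherwise the 3-space, which is its orthogonal complement, would contain a timelike
vector. -/
theorem inn_self_nonpos_of_normal {L : R3 →L[ℝ] R41} (hL : Function.Injective L)
    (hpos : ∀ v, L v ≠ 0 → 0 < inn (L v) (L v)) {w : R41} (hw : ∀ v, inn w (L v) = 0) :
    inn w w ≤ 0 := by
  by_contra! hlt
  let z : R41 := ![w 1 ^ 2 + w 2 ^ 2 + w 3 ^ 2, w 0 * w 1, w 0 * w 2, w 0 * w 3]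
  have hwz : inn w z = 0 := by
    simp [inn, z]
    ring
  have hzz : inn z z = -((w 1 ^ 2 + w 2 ^ 2 + w 3 ^ 2) * inn w w) := by
    simp [inn, z]
    ring
  have hw3 : 0 < w 1 ^ 2 + w 2 ^ 2 + w 3 ^ 2 := by
    simp only [inn] at hlt
    nlinarith [sq_nonneg (w 0)]
  have hw0 : (innL w : R41 →ₗ[ℝ] ℝ) ≠ 0 := fun h => by
    have : inn w w = 0 := LinearMap.congr_fun h w
    exact hlt.ne' this
  have hle : LinearMap.range (L : R3 →ₗ[ℝ] R41) ≤ LinearMap.ker (innL w : R41 →ₗ[ℝ] ℝ) := by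
    rintro _ ⟨v, rfl⟩
    exact hw v
  have heq : LinearMap.range (L : R3 →ₗ[ℝ] R41) = LinearMap.ker (innL w : R41 →ₗ[ℝ] ℝ) := by
    refine Submodule.eq_of_le_of_finrank_eq hle ?_
    have h1 := Module.Dual.finrank_ker_add_one_of_ne_zero hw0
    rw [LinearMap.finrank_range_of_inj hL]
    simp at h1 ⊢
    omega
  obtain ⟨v, hv⟩ : z ∈ LinearMap.range (L : R3 →ₗ[ℝ] R41) := heq ▸ hwz
  have hv : L v = z := hv
  have hz0 : z ≠ 0 := fun h => hw3.ne' (congrFun h 0)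
  have := hpos v (hv ▸ hz0)
  rw [hv, hzz] at this
  nlinarith [mul_pos hw3 hlt]

/-- A pseudo-orthonormal frame separates vectors. -/
theorem eq_zero_of_orthogonal_frame {a b c d : R41} (haa : inn a a = -1) (hbb : inn b b = 1)
    (hcc : inn c c = 1) (hdd : inn d d = 1) (hab : inn a b = 0) (hac : inn a c = 0)
    (had : inn a d = 0) (hbc : inn b c = 0) (hbd : inn b d = 0) (hcd : inn c d = 0) {x : R41}
    (ha : inn a x = 0) (hb : inn b x = 0) (hc : inn c x = 0) (hd : inn d x = 0) : x = 0 := by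
  let M : Matrix (Fin 4) (Fin 4) ℝ := Matrix.of ![a, b, c, d]
  let η : Matrix (Fin 4) (Fin 4) ℝ := Matrix.diagonal ![-1, 1, 1, 1]
  have hη' : ∀ (N : Matrix (Fin 4) (Fin 4) ℝ) (i j), (N * η * N.transpose) i j = inn (N i) (N j) := by
    intro N i j
    simp [Matrix.mul_apply, η, Matrix.diagonal_apply, Fin.sum_univ_succ, inn]
    ring
  have hMη : ∀ i j, (M * η * M.transpose) i j = inn (![a, b, c, d] i) (![a, b, c, d] j) := hη' M
  have hdet : M * η * M.transpose = η := by
    ext i j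
    rw [hMη]
    fin_cases i <;> fin_cases j <;>
      simp [η, *, inn_comm b a, inn_comm c a, inn_comm d a, inn_comm c b, inn_comm d b,
        inn_comm d c]
  have hη : η.det = -1 := by simp [η, Matrix.det_diagonal, Fin.prod_univ_succ]
  have hM : M.det ≠ 0 := fun h => by
    have := congrArg Matrix.det hdet
    rw [Matrix.det_mul, Matrix.det_mul, h, hη] at this
    norm_num at this
  have hx : M.mulVec ![-x 0, x 1, x 2, x 3] = 0 := by
    have hv : ∀ y : R41, ∑ i, y i * (![-x 0, x 1, x 2, x 3] : R41) i = inn y x := fun y => by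
      simp [Fin.sum_univ_succ, inn]
      ring
    ext i
    change ∑ j, M i j * (![-x 0, x 1, x 2, x 3] : R41) j = 0
    rw [hv]
    fin_cases i
    exacts [ha, hb, hc, hd]
  have h0 := Matrix.eq_zero_of_mulVec_eq_zero hM hx
  ext i
  have := congrFun h0 i
  fin_cases i <;> simpa using this

theorem inn_wedge_partialD (X : R3 → R41) (u v : R3) :
    inn (wedge (partialD X 0 u) (partialD X 1 u) (partialD X 2 u)) (fderiv ℝ X u v) = 0 := by
  have hv : fderiv ℝ X u v = v 0 • partialD X 0 u + v 1 • partialD X 1 u + v 2 • partialD X 2 u := by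
    simp only [partialD, ← map_smul, ← map_add]
    congr 1
    ext i
    fin_cases i <;> simp
  rw [hv]
  simp only [inn_add_right, inn_smul_right, inn_wedge_first, inn_wedge_second, inn_wedge_third]
  ring

theorem inn_unitNormal (X : R3 → R41) (u v : R3) :
    inn (unitNormal X u) (fderiv ℝ X u v) = 0 := by
  rw [unitNormal, inn_smul_left, inn_wedge_partialD, mul_zero]

namespace IsSpacelikeEmbedding

theorem inn_wedge_self_neg {U : Set R3} {X : R3 → R41} (h : IsSpacelikeEmbedding U X) {u : R3}
    (hu : u ∈ U) : inn (wedge (partialD X 0 u) (partialD X 1 u) (partialD X 2 u))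
      (wedge (partialD X 0 u) (partialD X 1 u) (partialD X 2 u)) < 0 := by
  refine lt_of_le_of_ne (inn_self_nonpos_of_normal (h.immersion u hu) (h.spacelike u hu)
    (inn_wedge_partialD X u)) fun h0 => ?_
  -- A lightlike vector product would have pseudo-norm `0`, and the unit normal would be `0`.
  have h1 := h.future u hu
  rw [unitNormal, pnorm, h0, abs_zero, Real.sqrt_zero, inv_zero, zero_smul, inn_zero_left] at h1
  exact h1.false

theorem inn_unitNormal_self {U : Set R3} {X : R3 → R41} (h : IsSpacelikeEmbedding U X) {u : R3}
    (hu : u ∈ U) : inn (unitNormal X u) (unitNormal X u) = -1 := by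
  have h1 := h.inn_wedge_self_neg hu
  have h2 := pnorm_sq (wedge (partialD X 0 u) (partialD X 1 u) (partialD X 2 u))
  rw [abs_of_neg h1] at h2
  rw [unitNormal, inn_smul_left, inn_smul_right, ← neg_eq_iff_eq_neg.2 h2]
  have h3 : pnorm (wedge (partialD X 0 u) (partialD X 1 u) (partialD X 2 u)) ≠ 0 := fun h0 => by
    rw [h0] at h2
    linarith
  field_simp

theorem contDiffOn_unitNormal {U : Set R3} {X : R3 → R41} (h : IsSpacelikeEmbedding U X) :
    ContDiffOn ℝ ∞ (unitNormal X) U := by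
  have h1 : ∀ i, ContDiffOn ℝ ∞ (partialD X i) U := fun i =>
    (h.contDiffOn.fderiv_of_isOpen h.isOpen (by simp)).clm_apply contDiffOn_const
  have h2 := contDiffOn_wedge (h1 0) (h1 1) (h1 2)
  refine ((contDiffOn_pnorm h2 fun u hu => (h.inn_wedge_self_neg hu).ne).inv fun u hu h0 => ?_).smul
    h2
  have h3 := pnorm_sq (wedge (partialD X 0 u) (partialD X 1 u) (partialD X 2 u))
  rw [h0, abs_of_neg (h.inn_wedge_self_neg hu)] at h3
  linarith [h.inn_wedge_self_neg hu]

end IsSpacelikeEmbedding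

theorem inn_deriv_add_eq_zero {f g : ℝ → R41} {J : Set ℝ} (hJ : IsOpen J)
    (hf : ContDiffOn ℝ ∞ f J) (hg : ContDiffOn ℝ ∞ g J) {a : ℝ} (h : ∀ s ∈ J, inn (f s) (g s) = a)
    {s : ℝ} (hs : s ∈ J) : inn (deriv f s) (g s) + inn (f s) (deriv g s) = 0 := by
  have h1 := hasDerivAt_inn (hf.hasDerivAt_of_isOpen hJ hs) (hg.hasDerivAt_of_isOpen hJ hs)
  have h2 : (fun s => inn (f s) (g s)) =ᶠ[𝓝 s] fun _ => a := by
    filter_upwards [hJ.mem_nhds hs] with y hy using h y hy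
  exact h1.unique ((hasDerivAt_const s a).congr_of_eventuallyEq h2)

namespace CurveInHypersurface

variable {Γ : CurveInHypersurface}

/-! ### Smoothness and the Darboux frame -/

theorem contDiffOn_γ : ContDiffOn ℝ ∞ Γ.γ Γ.I :=
  Γ.embedding.contDiffOn.comp Γ.smooth_γbar Γ.mapsTo_γbar

theorem contDiffOn_t : ContDiffOn ℝ ∞ Γ.t Γ.I :=
  contDiffOn_γ.deriv_of_isOpen Γ.isOpen_I (by simp)

theorem contDiffOn_deriv_t : ContDiffOn ℝ ∞ (deriv Γ.t) Γ.I :=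
  contDiffOn_t.deriv_of_isOpen Γ.isOpen_I (by simp)

theorem contDiffOn_nγ : ContDiffOn ℝ ∞ Γ.nγ Γ.I :=
  Γ.embedding.contDiffOn_unitNormal.comp Γ.smooth_γbar Γ.mapsTo_γbar

theorem contDiffOn_kn : ContDiffOn ℝ ∞ Γ.kn Γ.I :=
  (contDiffOn_inn contDiffOn_nγ contDiffOn_deriv_t).neg

theorem inn_nγ_nγ {s : ℝ} (hs : s ∈ Γ.I) : inn (Γ.nγ s) (Γ.nγ s) = -1 :=
  Γ.embedding.inn_unitNormal_self (Γ.mapsTo_γbar hs)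

theorem inn_t_t {s : ℝ} (hs : s ∈ Γ.I) : inn (Γ.t s) (Γ.t s) = 1 := Γ.unitSpeed s hs

theorem inn_nγ_t {s : ℝ} (hs : s ∈ Γ.I) : inn (Γ.nγ s) (Γ.t s) = 0 := by
  have h1 := ((Γ.embedding.contDiffOn.contDiffAt
    (Γ.embedding.isOpen.mem_nhds (Γ.mapsTo_γbar hs))).differentiableAt (by simp)).hasFDerivAt
  have h2 := h1.comp_hasDerivAt s (Γ.smooth_γbar.hasDerivAt_of_isOpen Γ.isOpen_I hs)
  rw [t, γ, h2.deriv]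
  exact inn_unitNormal _ _ _

theorem inn_t_deriv_t {s : ℝ} (hs : s ∈ Γ.I) : inn (Γ.t s) (deriv Γ.t s) = 0 := by
  have h := inn_deriv_add_eq_zero Γ.isOpen_I contDiffOn_t contDiffOn_t (fun _ => inn_t_t) hs
  rw [inn_comm (deriv Γ.t s)] at h
  linarith

/-- The part of `t'` tangent to the hypersurface, whose norm is `kg`, is orthogonal to the normal, and
hence not timelike. -/
theorem inn_nγ_geodesicPart {s : ℝ} (hs : s ∈ Γ.I) :
    inn (Γ.nγ s) (inn (Γ.nγ s) (deriv Γ.t s) • Γ.nγ s + deriv Γ.t s) = 0 := by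
  rw [inn_add_right, inn_smul_right, inn_nγ_nγ hs]
  ring

theorem kg_sq {s : ℝ} (hs : s ∈ Γ.I) : Γ.kg s ^ 2 =
    inn (inn (Γ.nγ s) (deriv Γ.t s) • Γ.nγ s + deriv Γ.t s)
      (inn (Γ.nγ s) (deriv Γ.t s) • Γ.nγ s + deriv Γ.t s) := by
  rw [kg, pnorm_sq, abs_of_nonneg]
  exact inn_self_nonneg_of_orthogonal (inn_nγ_nγ hs) (inn_nγ_geodesicPart hs)

theorem contDiffOn_geodesicPart :
    ContDiffOn ℝ ∞ (fun s => inn (Γ.nγ s) (deriv Γ.t s) • Γ.nγ s + deriv Γ.t s) Γ.I :=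
  ((contDiffOn_inn contDiffOn_nγ contDiffOn_deriv_t).smul contDiffOn_nγ).add contDiffOn_deriv_t

theorem contDiffOn_kg (hkg : ∀ s ∈ Γ.I, Γ.kg s ≠ 0) : ContDiffOn ℝ ∞ Γ.kg Γ.I :=
  contDiffOn_pnorm contDiffOn_geodesicPart fun s hs => by
    rw [← kg_sq hs]
    exact pow_ne_zero 2 (hkg s hs)

theorem contDiffOn_n1 (hkg : ∀ s ∈ Γ.I, Γ.kg s ≠ 0) : ContDiffOn ℝ ∞ Γ.n1 Γ.I :=
  ((contDiffOn_kg hkg).inv hkg).smul contDiffOn_geodesicPart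

theorem contDiffOn_n2 (hkg : ∀ s ∈ Γ.I, Γ.kg s ≠ 0) : ContDiffOn ℝ ∞ Γ.n2 Γ.I :=
  contDiffOn_wedge contDiffOn_nγ contDiffOn_t (contDiffOn_n1 hkg)

theorem inn_n1_n1 (hkg : ∀ s ∈ Γ.I, Γ.kg s ≠ 0) {s : ℝ} (hs : s ∈ Γ.I) :
    inn (Γ.n1 s) (Γ.n1 s) = 1 := by
  have := hkg s hs
  rw [n1, inn_smul_left, inn_smul_right, ← kg_sq hs]
  field_simp

theorem inn_nγ_n1 {s : ℝ} (hs : s ∈ Γ.I) : inn (Γ.nγ s) (Γ.n1 s) = 0 := by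
  rw [n1, inn_smul_right, inn_nγ_geodesicPart hs, mul_zero]

theorem inn_t_n1 {s : ℝ} (hs : s ∈ Γ.I) : inn (Γ.t s) (Γ.n1 s) = 0 := by
  rw [n1, inn_smul_right, inn_add_right, inn_smul_right, inn_t_deriv_t hs,
    inn_comm (Γ.t s) (Γ.nγ s), inn_nγ_t hs]
  ring

theorem inn_nγ_n2 (s : ℝ) : inn (Γ.nγ s) (Γ.n2 s) = 0 := by
  rw [inn_comm]
  exact inn_wedge_first _ _ _

theorem inn_t_n2 (s : ℝ) : inn (Γ.t s) (Γ.n2 s) = 0 := by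
  rw [inn_comm]
  exact inn_wedge_second _ _ _

theorem inn_n1_n2 (s : ℝ) : inn (Γ.n1 s) (Γ.n2 s) = 0 := by
  rw [inn_comm]
  exact inn_wedge_third _ _ _

theorem inn_n2_n2 (hkg : ∀ s ∈ Γ.I, Γ.kg s ≠ 0) {s : ℝ} (hs : s ∈ Γ.I) :
    inn (Γ.n2 s) (Γ.n2 s) = 1 := by
  rw [n2, inn_wedge_self, inn_nγ_nγ hs, inn_t_t hs, inn_n1_n1 hkg hs, inn_nγ_t hs, inn_nγ_n1 hs,
    inn_t_n1 hs]
  norm_num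

/-- The Darboux frame separates vectors. -/
theorem eq_of_inn_frame_eq (hkg : ∀ s ∈ Γ.I, Γ.kg s ≠ 0) {s : ℝ} (hs : s ∈ Γ.I) {x y : R41}
    (h0 : inn (Γ.nγ s) x = inn (Γ.nγ s) y) (ht : inn (Γ.t s) x = inn (Γ.t s) y)
    (h1 : inn (Γ.n1 s) x = inn (Γ.n1 s) y) (h2 : inn (Γ.n2 s) x = inn (Γ.n2 s) y) : x = y := by
  have key : ∀ a : R41, inn a x = inn a y → inn a (x - y) = 0 := fun a h => by
    rw [← innL_apply, map_sub, innL_apply, innL_apply, h, sub_self]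
  exact sub_eq_zero.1 (eq_zero_of_orthogonal_frame (inn_nγ_nγ hs) (inn_t_t hs) (inn_n1_n1 hkg hs)
    (inn_n2_n2 hkg hs) (inn_nγ_t hs) (inn_nγ_n1 hs) (inn_nγ_n2 s) (inn_t_n1 hs) (inn_t_n2 s)
    (inn_n1_n2 s) (key _ h0) (key _ ht) (key _ h1) (key _ h2))

theorem deriv_t_eq (hkg : ∀ s ∈ Γ.I, Γ.kg s ≠ 0) {s : ℝ} (hs : s ∈ Γ.I) :
    deriv Γ.t s = Γ.kn s • Γ.nγ s + Γ.kg s • Γ.n1 s := by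
  rw [n1, smul_inv_smul₀ (hkg s hs), kn]
  module

/-! ### The structure equations -/

theorem deriv_nγ_eq (hkg : ∀ s ∈ Γ.I, Γ.kg s ≠ 0) {s : ℝ} (hs : s ∈ Γ.I) :
    deriv Γ.nγ s = Γ.kn s • Γ.t s + Γ.τ1 s • Γ.n1 s + Γ.τ2 s • Γ.n2 s := by
  have h1 := inn_deriv_add_eq_zero Γ.isOpen_I contDiffOn_nγ contDiffOn_nγ (fun _ => inn_nγ_nγ) hs
  have h2 := inn_deriv_add_eq_zero Γ.isOpen_I contDiffOn_nγ contDiffOn_t (fun _ => inn_nγ_t) hs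
  rw [inn_comm (deriv Γ.nγ s)] at h1 h2
  refine eq_of_inn_frame_eq hkg hs ?_ ?_ ?_ ?_ <;>
    simp only [inn_add_right, inn_smul_right, inn_nγ_t hs, inn_nγ_n1 hs, inn_nγ_n2, inn_t_t hs,
      inn_t_n1 hs, inn_t_n2, inn_comm (Γ.n1 s) (Γ.t s), inn_n1_n1 hkg hs, inn_n1_n2,
      inn_comm (Γ.n2 s) (Γ.t s), inn_comm (Γ.n2 s) (Γ.n1 s), inn_n2_n2 hkg hs, kn, τ1, τ2]
  · linarith
  · linarith
  · ring
  · ring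

theorem deriv_n1_eq (hkg : ∀ s ∈ Γ.I, Γ.kg s ≠ 0) {s : ℝ} (hs : s ∈ Γ.I) :
    deriv Γ.n1 s = Γ.τ1 s • Γ.nγ s - Γ.kg s • Γ.t s + Γ.τg s • Γ.n2 s := by
  have hn1 := contDiffOn_n1 hkg
  have h1 := inn_deriv_add_eq_zero Γ.isOpen_I contDiffOn_nγ hn1 (fun _ => inn_nγ_n1) hs
  have h2 := inn_deriv_add_eq_zero Γ.isOpen_I contDiffOn_t hn1 (fun _ => inn_t_n1) hs
  have h3 := inn_deriv_add_eq_zero Γ.isOpen_I hn1 hn1 (fun _ => inn_n1_n1 hkg) hs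
  have h4 := inn_deriv_add_eq_zero Γ.isOpen_I hn1 (contDiffOn_n2 hkg) (fun s _ => inn_n1_n2 s) hs
  rw [inn_comm (deriv Γ.nγ s)] at h1
  rw [deriv_t_eq hkg hs, inn_add_left, inn_smul_left, inn_smul_left, inn_nγ_n1 hs,
    inn_n1_n1 hkg hs] at h2
  rw [inn_comm (deriv Γ.n1 s)] at h3 h4
  rw [sub_eq_add_neg, ← neg_smul]
  refine eq_of_inn_frame_eq hkg hs ?_ ?_ ?_ ?_ <;>
    simp only [inn_add_right, inn_smul_right, inn_nγ_nγ hs, inn_nγ_t hs, inn_nγ_n2, inn_t_t hs,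
      inn_t_n2, inn_comm (Γ.n1 s) (Γ.t s), inn_t_n1 hs, inn_n1_n2, inn_comm (Γ.n2 s) (Γ.t s),
      inn_comm (Γ.n2 s) (Γ.nγ s), inn_comm (Γ.n1 s) (Γ.nγ s), inn_nγ_n1 hs,
      inn_comm (Γ.t s) (Γ.nγ s), inn_n2_n2 hkg hs, τ1, τg]
  · linarith
  · linarith
  · linarith
  · rw [inn_neg_left, inn_comm (deriv Γ.n2 s)]
    linarith

theorem deriv_deriv_t_eq (hkg : ∀ s ∈ Γ.I, Γ.kg s ≠ 0) {s : ℝ} (hs : s ∈ Γ.I) :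
    deriv (deriv Γ.t) s = (deriv Γ.kn s + Γ.kg s * Γ.τ1 s) • Γ.nγ s
      + (Γ.kn s ^ 2 - Γ.kg s ^ 2) • Γ.t s + (Γ.kn s * Γ.τ1 s + deriv Γ.kg s) • Γ.n1 s
      + (Γ.kn s * Γ.τ2 s + Γ.kg s * Γ.τg s) • Γ.n2 s := by
  have h1 : HasDerivAt (fun s => Γ.kn s • Γ.nγ s + Γ.kg s • Γ.n1 s) _ s :=
    ((contDiffOn_kn.hasDerivAt_of_isOpen Γ.isOpen_I hs).smul
      (contDiffOn_nγ.hasDerivAt_of_isOpen Γ.isOpen_I hs)).add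
    (((contDiffOn_kg hkg).hasDerivAt_of_isOpen Γ.isOpen_I hs).smul
      ((contDiffOn_n1 hkg).hasDerivAt_of_isOpen Γ.isOpen_I hs))
  have h2 : deriv Γ.t =ᶠ[𝓝 s] fun s => Γ.kn s • Γ.nγ s + Γ.kg s • Γ.n1 s := by
    filter_upwards [Γ.isOpen_I.mem_nhds hs] with y hy using deriv_t_eq hkg hy
  rw [h2.deriv_eq, h1.deriv, deriv_nγ_eq hkg hs, deriv_n1_eq hkg hs]
  module

/-! ### The hyperbolic surface -/

theorem inn_S_left (s θ : ℝ) (x : R41) : inn (Γ.S s θ) x =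
    Real.cosh θ / √(Γ.kg s ^ 2 - Γ.kn s ^ 2)
      * (Γ.kg s * inn (Γ.nγ s) x + Γ.kn s * inn (Γ.n1 s) x) + Real.sinh θ * inn (Γ.n2 s) x := by
  simp only [S, inn_add_left, inn_smul_left]

theorem inn_nγ_S {s : ℝ} (hs : s ∈ Γ.I) (θ : ℝ) :
    inn (Γ.nγ s) (Γ.S s θ) = -(Real.cosh θ / √(Γ.kg s ^ 2 - Γ.kn s ^ 2) * Γ.kg s) := by
  rw [inn_comm, inn_S_left, inn_nγ_nγ hs, inn_comm (Γ.n1 s), inn_nγ_n1 hs, inn_comm (Γ.n2 s),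
    inn_nγ_n2]
  ring

theorem inn_t_S {s : ℝ} (hs : s ∈ Γ.I) (θ : ℝ) : inn (Γ.t s) (Γ.S s θ) = 0 := by
  rw [inn_comm, inn_S_left, inn_nγ_t hs, inn_comm (Γ.n1 s), inn_t_n1 hs, inn_comm (Γ.n2 s),
    inn_t_n2]
  ring

theorem inn_n1_S (hkg : ∀ s ∈ Γ.I, Γ.kg s ≠ 0) {s : ℝ} (hs : s ∈ Γ.I) (θ : ℝ) :
    inn (Γ.n1 s) (Γ.S s θ) = Real.cosh θ / √(Γ.kg s ^ 2 - Γ.kn s ^ 2) * Γ.kn s := by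
  rw [inn_comm, inn_S_left, inn_nγ_n1 hs, inn_n1_n1 hkg hs, inn_comm (Γ.n2 s), inn_n1_n2]
  ring

theorem inn_n2_S (hkg : ∀ s ∈ Γ.I, Γ.kg s ≠ 0) {s : ℝ} (hs : s ∈ Γ.I) (θ : ℝ) :
    inn (Γ.n2 s) (Γ.S s θ) = Real.sinh θ := by
  rw [inn_comm, inn_S_left, inn_nγ_n2, inn_n1_n2, inn_n2_n2 hkg hs]
  ring

theorem inn_S_S (hkg : ∀ s ∈ Γ.I, Γ.kg s ≠ 0) {s : ℝ} (hs : s ∈ Γ.I)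
    (hk : Γ.kn s ^ 2 < Γ.kg s ^ 2) (θ : ℝ) : inn (Γ.S s θ) (Γ.S s θ) = -1 := by
  rw [inn_S_left, inn_nγ_S hs, inn_n1_S hkg hs, inn_n2_S hkg hs]
  have h1 : √(Γ.kg s ^ 2 - Γ.kn s ^ 2) ^ 2 = Γ.kg s ^ 2 - Γ.kn s ^ 2 :=
    Real.sq_sqrt (by linarith)
  have h2 : √(Γ.kg s ^ 2 - Γ.kn s ^ 2) ≠ 0 := (Real.sqrt_pos.2 (by linarith)).ne'
  field_simp
  linear_combination (Real.cosh θ ^ 2) * h1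
    - √(Γ.kg s ^ 2 - Γ.kn s ^ 2) ^ 2 * Real.cosh_sq θ

theorem inn_deriv_t_S (hkg : ∀ s ∈ Γ.I, Γ.kg s ≠ 0) {s : ℝ} (hs : s ∈ Γ.I) (θ : ℝ) :
    inn (deriv Γ.t s) (Γ.S s θ) = 0 := by
  rw [deriv_t_eq hkg hs, inn_add_left, inn_smul_left, inn_smul_left, inn_nγ_S hs,
    inn_n1_S hkg hs]
  ring

theorem inn_deriv_deriv_t_S (hkg : ∀ s ∈ Γ.I, Γ.kg s ≠ 0) {s : ℝ} (hs : s ∈ Γ.I) (θ : ℝ) :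
    inn (deriv (deriv Γ.t) s) (Γ.S s θ) =
      Real.sinh θ * (Γ.kn s * Γ.τ2 s + Γ.kg s * Γ.τg s)
        - Real.cosh θ / √(Γ.kg s ^ 2 - Γ.kn s ^ 2) * Γ.lam0 s := by
  simp only [deriv_deriv_t_eq hkg hs, inn_add_left, inn_smul_left, inn_nγ_S hs,
    inn_n1_S hkg hs, inn_t_S hs, inn_n2_S hkg hs, lam0]
  ring

theorem inn_deriv_deriv_t_S_eq_zero_iff (hkg : ∀ s ∈ Γ.I, Γ.kg s ≠ 0) {s : ℝ} (hs : s ∈ Γ.I)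
    (hτ : Γ.kn s * Γ.τ2 s + Γ.kg s * Γ.τg s ≠ 0) (hk : Γ.kn s ^ 2 < Γ.kg s ^ 2) (θ : ℝ) :
    inn (deriv (deriv Γ.t) s) (Γ.S s θ) = 0 ↔ Real.tanh θ = Γ.tanhAngle s := by
  have h2 : √(Γ.kg s ^ 2 - Γ.kn s ^ 2) ≠ 0 := (Real.sqrt_pos.2 (by linarith)).ne'
  have h3 := (Real.cosh_pos θ).ne'
  rw [inn_deriv_deriv_t_S hkg hs, Real.tanh_eq_sinh_div_cosh, tanhAngle,
    div_eq_div_iff h3 (mul_ne_zero hτ h2), sub_eq_zero, div_mul_eq_mul_div, eq_div_iff h2]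
  constructor <;> intro h <;> linarith

/-- The point `S s θ` and the first three derivatives of the curve are linearly independent if the
third derivative is orthogonal to `S s θ`. -/
theorem eq_zero_of_orthogonal (hkg : ∀ s ∈ Γ.I, Γ.kg s ≠ 0) {s : ℝ} (hs : s ∈ Γ.I)
    (hτ : Γ.kn s * Γ.τ2 s + Γ.kg s * Γ.τg s ≠ 0) (hk : Γ.kn s ^ 2 < Γ.kg s ^ 2) {θ : ℝ}
    (hθ : inn (deriv (deriv Γ.t) s) (Γ.S s θ) = 0) {x : R41} (h0 : inn (Γ.t s) x = 0)
    (h1 : inn (deriv Γ.t s) x = 0) (h2 : inn (deriv (deriv Γ.t) s) x = 0)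
    (hS : inn (Γ.S s θ) x = 0) : x = 0 := by
  rw [inn_deriv_deriv_t_S hkg hs] at hθ
  rw [deriv_t_eq hkg hs, inn_add_left, inn_smul_left, inn_smul_left] at h1
  simp only [deriv_deriv_t_eq hkg hs, inn_add_left, inn_smul_left, h0] at h2
  rw [inn_S_left] at hS
  have hD1 : √(Γ.kg s ^ 2 - Γ.kn s ^ 2) ^ 2 = Γ.kg s ^ 2 - Γ.kn s ^ 2 :=
    Real.sq_sqrt (by linarith)
  have hD2 : √(Γ.kg s ^ 2 - Γ.kn s ^ 2) ≠ 0 := (Real.sqrt_pos.2 (by linarith)).ne'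
  have hcs := Real.cosh_sq θ
  have hg := hkg s hs
  set D := √(Γ.kg s ^ 2 - Γ.kn s ^ 2)
  -- By `h1` the components of `x` along `nγ` and `n1` are `ν kg` and `-ν kn`.
  obtain ⟨ν, hν⟩ : ∃ ν, inn (Γ.nγ s) x = ν * Γ.kg s := ⟨inn (Γ.nγ s) x / Γ.kg s, by field_simp⟩
  have hν1 : inn (Γ.n1 s) x = -(ν * Γ.kn s) := by
    rw [hν] at h1
    refine mul_left_cancel₀ hg ?_
    linarith
  rw [hν, hν1] at hS h2
  -- `(ν D, ⟨n2, x⟩)` is in the kernel of the hyperbolic rotation by `θ`, so it vanishes.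
  have e1 : ν * D * Real.cosh θ + Real.sinh θ * inn (Γ.n2 s) x = 0 := by
    field_simp at hS
    refine mul_left_cancel₀ hD2 ?_
    linear_combination hS + ν * Real.cosh θ * hD1
  have e2 : ν * D * Real.sinh θ + Real.cosh θ * inn (Γ.n2 s) x = 0 := by
    field_simp at hθ
    simp only [lam0] at hθ
    refine mul_left_cancel₀ hτ ?_
    linear_combination ν * hθ + Real.cosh θ * h2
  have hn2 : inn (Γ.n2 s) x = 0 := by
    linear_combination Real.cosh θ * e2 - Real.sinh θ * e1 - inn (Γ.n2 s) x * hcs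
  have hν0 : ν = 0 := by
    have : ν * D = 0 := by
      linear_combination Real.cosh θ * e1 - Real.sinh θ * e2 - ν * D * hcs
    exact (mul_eq_zero.1 this).resolve_right hD2
  rw [hν0, zero_mul] at hν
  rw [hν0, zero_mul, neg_zero] at hν1
  exact eq_of_inn_frame_eq hkg hs (by rw [hν, inn_zero_right]) (by rw [h0, inn_zero_right])
    (by rw [hν1, inn_zero_right]) (by rw [hn2, inn_zero_right])

/-! ### The hyperbolic curve -/

theorem contDiffOn_tanhAngle (hkg : ∀ s ∈ Γ.I, Γ.kg s ≠ 0)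
    (hτ : ∀ s ∈ Γ.I, Γ.kn s * Γ.τ2 s + Γ.kg s * Γ.τg s ≠ 0)
    (hk : ∀ s ∈ Γ.I, Γ.kn s ^ 2 < Γ.kg s ^ 2) : ContDiffOn ℝ ∞ Γ.tanhAngle Γ.I := by
  have hd : ∀ {f : ℝ → ℝ}, ContDiffOn ℝ ∞ f Γ.I → ContDiffOn ℝ ∞ (deriv f) Γ.I := fun hf =>
    hf.deriv_of_isOpen Γ.isOpen_I (by simp)
  have hd' : ∀ {f : ℝ → R41}, ContDiffOn ℝ ∞ f Γ.I → ContDiffOn ℝ ∞ (deriv f) Γ.I := fun hf =>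
    hf.deriv_of_isOpen Γ.isOpen_I (by simp)
  have h1 : ContDiffOn ℝ ∞ Γ.kn Γ.I := contDiffOn_kn
  have h2 := contDiffOn_kg hkg
  have h3 : ContDiffOn ℝ ∞ Γ.τ1 Γ.I := contDiffOn_inn (contDiffOn_n1 hkg) (hd' contDiffOn_nγ)
  have h4 : ContDiffOn ℝ ∞ Γ.τ2 Γ.I := contDiffOn_inn (contDiffOn_n2 hkg) (hd' contDiffOn_nγ)
  have h5 : ContDiffOn ℝ ∞ Γ.τg Γ.I :=
    contDiffOn_inn (hd' (contDiffOn_n2 hkg)).neg (contDiffOn_n1 hkg)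
  have h6 : ContDiffOn ℝ ∞ Γ.lam0 Γ.I :=
    (((h2.mul (hd h1)).add ((h2.pow 2).mul h3)).sub ((h1.pow 2).mul h3)).sub (h1.mul (hd h2))
  have h7 : ContDiffOn ℝ ∞ (fun s => √(Γ.kg s ^ 2 - Γ.kn s ^ 2)) Γ.I :=
    ((h2.pow 2).sub (h1.pow 2)).sqrt fun s hs => (sub_pos.2 (hk s hs)).ne'
  exact h6.div (((h1.mul h4).add (h2.mul h5)).mul h7) fun s hs =>
    mul_ne_zero (hτ s hs) (Real.sqrt_pos.2 (sub_pos.2 (hk s hs))).ne'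

theorem contDiffOn_CH (hkg : ∀ s ∈ Γ.I, Γ.kg s ≠ 0)
    (hτ : ∀ s ∈ Γ.I, Γ.kn s * Γ.τ2 s + Γ.kg s * Γ.τg s ≠ 0)
    (hk : ∀ s ∈ Γ.I, Γ.kn s ^ 2 < Γ.kg s ^ 2) :
    ContDiffOn ℝ ∞ Γ.CH {s ∈ Γ.I | |Γ.tanhAngle s| < 1} := by
  have hsub : {s ∈ Γ.I | |Γ.tanhAngle s| < 1} ⊆ Γ.I := fun s hs => hs.1
  have h0 := (contDiffOn_tanhAngle hkg hτ hk).mono hsub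
  have h1 : ContDiffOn ℝ ∞ Γ.kn _ := contDiffOn_kn.mono hsub
  have h2 := (contDiffOn_kg hkg).mono hsub
  have h7 : ContDiffOn ℝ ∞ (fun s => √(Γ.kg s ^ 2 - Γ.kn s ^ 2)) {s ∈ Γ.I | |Γ.tanhAngle s| < 1} :=
    ((h2.pow 2).sub (h1.pow 2)).sqrt fun s hs => (sub_pos.2 (hk s hs.1)).ne'
  have hθ : ContDiffOn ℝ ∞ (fun s => Real.artanh (Γ.tanhAngle s))
      {s ∈ Γ.I | |Γ.tanhAngle s| < 1} := by
    have hpos : ∀ s ∈ {s ∈ Γ.I | |Γ.tanhAngle s| < 1},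
        0 < 1 + Γ.tanhAngle s ∧ 0 < 1 - Γ.tanhAngle s := fun s hs => by
      have := abs_lt.1 hs.2
      constructor <;> linarith
    simp only [Real.artanh]
    have hq : ContDiffOn ℝ ∞ (fun s => √((1 + Γ.tanhAngle s) / (1 - Γ.tanhAngle s)))
        {s ∈ Γ.I | |Γ.tanhAngle s| < 1} :=
      ((contDiffOn_const.add h0).div (contDiffOn_const.sub h0) fun s hs => (hpos s hs).2.ne').sqrt
        fun s hs => (div_pos (hpos s hs).1 (hpos s hs).2).ne'
    exact hq.log fun s hs => (Real.sqrt_pos.2 (div_pos (hpos s hs).1 (hpos s hs).2)).ne'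
  have hS : ∀ s ∈ {s ∈ Γ.I | |Γ.tanhAngle s| < 1}, √(Γ.kg s ^ 2 - Γ.kn s ^ 2) ≠ 0 := fun s hs =>
    (Real.sqrt_pos.2 (sub_pos.2 (hk s hs.1))).ne'
  exact (((hθ.cosh).div h7 hS).smul
    ((h2.smul (contDiffOn_nγ.mono hsub)).add (h1.smul ((contDiffOn_n1 hkg).mono hsub)))).add
    (hθ.sinh.smul ((contDiffOn_n2 hkg).mono hsub))

end CurveInHypersurface

/-! ### Orthogonality relations and contact -/

theorem hasDerivAt_inn_iteratedDeriv {T V : ℝ → R41} {J : Set ℝ} (hJ : IsOpen J)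
    (hT : ContDiffOn ℝ ∞ T J) (hV : ContDiffOn ℝ ∞ V J) (i j : ℕ) {s : ℝ} (hs : s ∈ J) :
    HasDerivAt (fun s => inn (iteratedDeriv i T s) (iteratedDeriv j V s))
      (inn (iteratedDeriv (i + 1) T s) (iteratedDeriv j V s)
        + inn (iteratedDeriv i T s) (iteratedDeriv (j + 1) V s)) s := by
  have h1 := (hT.iteratedDeriv_of_isOpen hJ i).hasDerivAt_of_isOpen hJ hs
  have h2 := (hV.iteratedDeriv_of_isOpen hJ j).hasDerivAt_of_isOpen hJ hs
  rw [← iteratedDeriv_succ] at h1 h2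
  exact hasDerivAt_inn h1 h2

theorem iteratedDeriv_inn_right {V : ℝ → R41} {J : Set ℝ} (hJ : IsOpen J)
    (hV : ContDiffOn ℝ ∞ V J) (x : R41) (k : ℕ) :
    ∀ s ∈ J, iteratedDeriv k (fun s => inn x (V s)) s = inn x (iteratedDeriv k V s) := by
  induction k with
  | zero => simp
  | succ k ih =>
    intro s hs
    have h1 : iteratedDeriv k (fun s => inn x (V s)) =ᶠ[𝓝 s] fun s => inn x (iteratedDeriv k V s) := by
      filter_upwards [hJ.mem_nhds hs] with y hy using ih y hy
    have h2 := (hV.iteratedDeriv_of_isOpen hJ k).hasDerivAt_of_isOpen hJ hs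
    rw [← iteratedDeriv_succ] at h2
    rw [iteratedDeriv_succ, h1.deriv_eq, (hasDerivAt_inn (hasDerivAt_const s x) h2).deriv,
      inn_zero_left, zero_add]

/-- Relations between the derivatives of a curve `T` and those of a curve `V` that is orthogonal to
`T`, `T'` and `T''`: repeated differentiation moves derivatives from one factor to the other. -/
theorem inn_iteratedDeriv_relations {T V : ℝ → R41} {J : Set ℝ} (hJ : IsOpen J)
    (hT : ContDiffOn ℝ ∞ T J) (hV : ContDiffOn ℝ ∞ V J)
    (h : ∀ i ≤ 2, ∀ s ∈ J, inn (iteratedDeriv i T s) (V s) = 0) {s : ℝ} (hs : s ∈ J) :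
    inn (T s) (deriv V s) = 0 ∧ inn (iteratedDeriv 1 T s) (deriv V s) = 0 ∧
    inn (iteratedDeriv 2 T s) (deriv V s) = -inn (iteratedDeriv 3 T s) (V s) ∧
    (deriv V s = 0 →
      inn (iteratedDeriv 2 T s) (iteratedDeriv 2 V s) = -inn (iteratedDeriv 4 T s) (V s) ∧
      inn (iteratedDeriv 1 T s) (iteratedDeriv 2 V s) = 0 ∧
      inn (iteratedDeriv 1 T s) (iteratedDeriv 3 V s) = 2 * inn (iteratedDeriv 4 T s) (V s)) := by
  let a : ℕ → ℕ → ℝ → ℝ := fun i j s => inn (iteratedDeriv i T s) (iteratedDeriv j V s)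
  have ha : ∀ i j, ∀ s ∈ J, HasDerivAt (a i j) (a (i + 1) j s + a i (j + 1) s) s := fun i j s hs =>
    hasDerivAt_inn_iteratedDeriv hJ hT hV i j hs
  have hz : ∀ {f : ℝ → ℝ} {f' s : ℝ}, (∀ s ∈ J, f s = 0) → s ∈ J → HasDerivAt f f' s → f' = 0 := by
    intro f f' s hf hs hd
    refine hd.unique ((hasDerivAt_const s 0).congr_of_eventuallyEq ?_)
    filter_upwards [hJ.mem_nhds hs] with y hy using hf y hy
  have h0 : ∀ i ≤ 2, ∀ s ∈ J, a i 0 s = 0 := fun i hi s hs => by simpa [a] using h i hi s hs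
  have h01 : ∀ s ∈ J, a 0 1 s = 0 := fun s hs => by
    have := hz (h0 0 (by norm_num)) hs (ha 0 0 s hs)
    linarith [h0 1 (by norm_num) s hs]
  have h11 : ∀ s ∈ J, a 1 1 s = 0 := fun s hs => by
    have := hz (h0 1 (by norm_num)) hs (ha 1 0 s hs)
    linarith [h0 2 (by norm_num) s hs]
  have h21 : ∀ s ∈ J, a 3 0 s + a 2 1 s = 0 := fun s hs => hz (h0 2 le_rfl) hs (ha 2 0 s hs)
  have h12 : ∀ s ∈ J, a 2 1 s + a 1 2 s = 0 := fun s hs => hz h11 hs (ha 1 1 s hs)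
  have h31 := hz h21 hs ((ha 3 0 s hs).add (ha 2 1 s hs))
  have h22 := hz h12 hs ((ha 2 1 s hs).add (ha 1 2 s hs))
  have e := h21 s hs
  have e' := h12 s hs
  have e0 := h01 s hs
  have e1 := h11 s hs
  simp only [a, iteratedDeriv_zero, iteratedDeriv_one, zero_add, Nat.reduceAdd]
    at e e' e0 e1 h31 h22 ⊢
  refine ⟨e0, e1, by linarith, fun hV0 => ?_⟩
  simp only [hV0, inn_zero_right] at h31 h22 e'
  refine ⟨?_, ?_, ?_⟩ <;> linarith

namespace CurveInHypersurface

variable {Γ : CurveInHypersurface}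

theorem iteratedDeriv_hT (v : R41) (k : ℕ) {s : ℝ} (hs : s ∈ Γ.I) :
    iteratedDeriv k (Γ.hT v) s = inn (iteratedDeriv k Γ.t s) v := by
  have h1 : Γ.hT v = fun s => inn v (Γ.t s) := funext fun s => inn_comm _ _
  rw [h1, iteratedDeriv_inn_right Γ.isOpen_I contDiffOn_t v k s hs, inn_comm]

theorem iteratedDeriv_succ_heightFn (v : R41) (c : ℝ) (k : ℕ) {s : ℝ} (hs : s ∈ Γ.I) :
    iteratedDeriv (k + 1) (heightFn v c ∘ Γ.γ) s = iteratedDeriv k (Γ.hT v) s := by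
  rw [iteratedDeriv_succ']
  refine Filter.EventuallyEq.iteratedDeriv_eq k ?_
  filter_upwards [Γ.isOpen_I.mem_nhds hs] with y hy
  have h1 := (hasDerivAt_inn (contDiffOn_γ.hasDerivAt_of_isOpen Γ.isOpen_I hy)
    (hasDerivAt_const y v)).sub_const c
  rw [inn_zero_right, add_zero] at h1
  exact h1.deriv

theorem vanishesToOrder_succ_heightFn_iff (v : R41) {s : ℝ} (hs : s ∈ Γ.I) (k : ℕ) :
    VanishesToOrder (heightFn v (inn (Γ.γ s) v) ∘ Γ.γ) (k + 1) s ↔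
      VanishesToOrder (Γ.hT v) k s := by
  constructor
  · intro h i hi
    rw [← iteratedDeriv_succ_heightFn v (inn (Γ.γ s) v) i hs]
    exact h (i + 1) (by omega)
  · rintro h (_ | i) hi
    · simp [heightFn]
    · rw [iteratedDeriv_succ_heightFn v _ i hs]
      exact h i (by omega)

theorem hasContact_succ_iff (v : R41) {s : ℝ} (hs : s ∈ Γ.I) (k : ℕ) :
    HasContact (heightFn v (inn (Γ.γ s) v)) Γ.γ (k + 1) s ↔ HasASingularity (Γ.hT v) k s := by
  rw [HasContact, HasASingularity, HasASingularity, vanishesToOrder_succ_heightFn_iff v hs,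
    iteratedDeriv_succ_heightFn v _ _ hs]

/-- If `(h_t^T)_{v₀}`, with `v₀ = S s₀ θ₀`, vanishes to order at least 2 at `s₀`, then the hyperbolic
curve is defined at `s₀` and passes through `v₀`. -/
theorem CH_eq_of_vanishesToOrder (hkg : ∀ s ∈ Γ.I, Γ.kg s ≠ 0)
    (hτ : ∀ s ∈ Γ.I, Γ.kn s * Γ.τ2 s + Γ.kg s * Γ.τg s ≠ 0)
    (hk : ∀ s ∈ Γ.I, Γ.kn s ^ 2 < Γ.kg s ^ 2) {s₀ : ℝ} (hs₀ : s₀ ∈ Γ.I) {θ₀ : ℝ}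
    (h : VanishesToOrder (Γ.hT (Γ.S s₀ θ₀)) 2 s₀) :
    |Γ.tanhAngle s₀| < 1 ∧ Γ.CH s₀ = Γ.S s₀ θ₀ := by
  have h2 := h 2 le_rfl
  rw [iteratedDeriv_hT _ _ hs₀, iteratedDeriv_succ, iteratedDeriv_one,
    inn_deriv_deriv_t_S_eq_zero_iff hkg hs₀ (hτ _ hs₀) (hk _ hs₀)] at h2
  rw [CH, ← h2, Real.artanh_tanh]
  exact ⟨abs_lt.2 ⟨Real.neg_one_lt_tanh θ₀, Real.tanh_lt_one θ₀⟩, rfl⟩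

theorem inn_iteratedDeriv_t_CH (hkg : ∀ s ∈ Γ.I, Γ.kg s ≠ 0)
    (hτ : ∀ s ∈ Γ.I, Γ.kn s * Γ.τ2 s + Γ.kg s * Γ.τg s ≠ 0)
    (hk : ∀ s ∈ Γ.I, Γ.kn s ^ 2 < Γ.kg s ^ 2) (i : ℕ) (hi : i ≤ 2) {s : ℝ} (hs : s ∈ Γ.I)
    (ha : |Γ.tanhAngle s| < 1) : inn (iteratedDeriv i Γ.t s) (Γ.CH s) = 0 := by
  interval_cases i
  · rw [iteratedDeriv_zero]
    exact inn_t_S hs _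
  · rw [iteratedDeriv_one]
    exact inn_deriv_t_S hkg hs _
  · rw [iteratedDeriv_succ, iteratedDeriv_one]
    exact (inn_deriv_deriv_t_S_eq_zero_iff hkg hs (hτ s hs) (hk s hs) _).2
      (Real.tanh_artanh (abs_lt.1 ha))

/-- Where the hyperbolic curve is defined, `t, t', t'', CH` is a basis. -/
theorem eq_zero_of_orthogonal_CH (hkg : ∀ s ∈ Γ.I, Γ.kg s ≠ 0)
    (hτ : ∀ s ∈ Γ.I, Γ.kn s * Γ.τ2 s + Γ.kg s * Γ.τg s ≠ 0)
    (hk : ∀ s ∈ Γ.I, Γ.kn s ^ 2 < Γ.kg s ^ 2) {s : ℝ} (hs : s ∈ Γ.I)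
    (ha : |Γ.tanhAngle s| < 1) {x : R41} (h2 : inn (iteratedDeriv 2 Γ.t s) x = 0)
    (h1 : inn (iteratedDeriv 1 Γ.t s) x = 0) (h0 : inn (Γ.t s) x = 0)
    (hx : inn (Γ.CH s) x = 0) : x = 0 := by
  have hCH := inn_iteratedDeriv_t_CH hkg hτ hk 2 le_rfl hs ha
  rw [iteratedDeriv_succ, iteratedDeriv_one] at h2 hCH
  rw [iteratedDeriv_one] at h1
  exact eq_zero_of_orthogonal hkg hs (hτ s hs) (hk s hs) hCH h0 h1 h2 hx

theorem isOpen_domain_CH (hkg : ∀ s ∈ Γ.I, Γ.kg s ≠ 0)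
    (hτ : ∀ s ∈ Γ.I, Γ.kn s * Γ.τ2 s + Γ.kg s * Γ.τg s ≠ 0)
    (hk : ∀ s ∈ Γ.I, Γ.kn s ^ 2 < Γ.kg s ^ 2) :
    IsOpen {s ∈ Γ.I | |Γ.tanhAngle s| < 1} :=
  (contDiffOn_tanhAngle hkg hτ hk).continuousOn.abs.isOpen_inter_preimage Γ.isOpen_I isOpen_Iio

/-- The hyperbolic curve is locally diffeomorphic to a line where `⟨t''', CH⟩ ≠ 0`. -/
theorem imageGermDiffeomorphic_CH_lineModel (hkg : ∀ s ∈ Γ.I, Γ.kg s ≠ 0)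
    (hτ : ∀ s ∈ Γ.I, Γ.kn s * Γ.τ2 s + Γ.kg s * Γ.τg s ≠ 0)
    (hk : ∀ s ∈ Γ.I, Γ.kn s ^ 2 < Γ.kg s ^ 2) {s₀ : ℝ} (hs₀ : s₀ ∈ Γ.I)
    (ha : |Γ.tanhAngle s₀| < 1) (h3 : inn (iteratedDeriv 3 Γ.t s₀) (Γ.CH s₀) ≠ 0) :
    ImageGermDiffeomorphic H3 Γ.CH s₀ lineModel 0 := by
  have hJ := isOpen_domain_CH hkg hτ hk
  have hJ₀ : s₀ ∈ {s ∈ Γ.I | |Γ.tanhAngle s| < 1} := ⟨hs₀, ha⟩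
  have hV := contDiffOn_CH hkg hτ hk
  have h0 := fun i hi (s : ℝ) (hs : s ∈ {s ∈ Γ.I | |Γ.tanhAngle s| < 1}) =>
    inn_iteratedDeriv_t_CH hkg hτ hk i hi hs.1 hs.2
  obtain ⟨-, -, h, -⟩ := inn_iteratedDeriv_relations hJ (contDiffOn_t.mono fun s hs => hs.1) hV h0 hJ₀
  refine imageGermDiffeomorphic_lineModel (hJ.mem_nhds hJ₀) hV ?_
    (l₁ := innL (iteratedDeriv 2 Γ.t s₀)) (l₂ := innL (iteratedDeriv 1 Γ.t s₀))
    (l₃ := innL (Γ.t s₀)) (h0 2 le_rfl s₀ hJ₀) (h0 1 one_le_two s₀ hJ₀)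
    (by simpa using h0 0 zero_le_two s₀ hJ₀) ?_ ?_
  · filter_upwards [hJ.mem_nhds hJ₀] with s hs using inn_S_S hkg hs.1 (hk s hs.1) _
  · exact fun x => eq_zero_of_orthogonal_CH hkg hτ hk hs₀ ha
  · have h1 := hasDerivAt_inn (hasDerivAt_const s₀ (iteratedDeriv 2 Γ.t s₀))
      (hV.hasDerivAt_of_isOpen hJ hJ₀)
    rw [inn_zero_left, zero_add, h] at h1
    exact h1.deriv ▸ neg_ne_zero.2 h3

/-- The hyperbolic curve is locally diffeomorphic to the `(2,3,4)`-cusp where `⟨t''', CH⟩` vanishes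
and `⟨t'''', CH⟩` does not. -/
theorem imageGermDiffeomorphic_CH_cusp234 (hkg : ∀ s ∈ Γ.I, Γ.kg s ≠ 0)
    (hτ : ∀ s ∈ Γ.I, Γ.kn s * Γ.τ2 s + Γ.kg s * Γ.τg s ≠ 0)
    (hk : ∀ s ∈ Γ.I, Γ.kn s ^ 2 < Γ.kg s ^ 2) {s₀ : ℝ} (hs₀ : s₀ ∈ Γ.I)
    (ha : |Γ.tanhAngle s₀| < 1) (h3 : inn (iteratedDeriv 3 Γ.t s₀) (Γ.CH s₀) = 0)
    (h4 : inn (iteratedDeriv 4 Γ.t s₀) (Γ.CH s₀) ≠ 0) :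
    ImageGermDiffeomorphic H3 Γ.CH s₀ cusp234 0 := by
  have hJ := isOpen_domain_CH hkg hτ hk
  have hJ₀ : s₀ ∈ {s ∈ Γ.I | |Γ.tanhAngle s| < 1} := ⟨hs₀, ha⟩
  have hV := contDiffOn_CH hkg hτ hk
  have h0 := fun i hi (s : ℝ) (hs : s ∈ {s ∈ Γ.I | |Γ.tanhAngle s| < 1}) =>
    inn_iteratedDeriv_t_CH hkg hτ hk i hi hs.1 hs.2
  obtain ⟨r0, r1, r2, r⟩ :=
    inn_iteratedDeriv_relations hJ (contDiffOn_t.mono fun s hs => hs.1) hV h0 hJ₀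
  have hl : ∀ x, innL (iteratedDeriv 2 Γ.t s₀) x = 0 → innL (iteratedDeriv 1 Γ.t s₀) x = 0 →
      innL (Γ.t s₀) x = 0 → inn (Γ.CH s₀) x = 0 → x = 0 :=
    fun x => eq_zero_of_orthogonal_CH hkg hτ hk hs₀ ha
  have hN : ∀ s ∈ {s ∈ Γ.I | |Γ.tanhAngle s| < 1}, inn (Γ.CH s) (Γ.CH s) = -1 := fun s hs =>
    inn_S_S hkg hs.1 (hk s hs.1) _
  have hV0 : deriv Γ.CH s₀ = 0 := by
    refine hl _ ?_ r1 r0 ?_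
    · rw [innL_apply, r2, h3, neg_zero]
    · have := inn_deriv_add_eq_zero hJ hV hV hN hJ₀
      rw [inn_comm (deriv Γ.CH s₀)] at this
      linarith
  obtain ⟨r22, r12, r13⟩ := r hV0
  have hi := fun x k => iteratedDeriv_inn_right hJ hV x k s₀ hJ₀
  refine imageGermDiffeomorphic_cusp234 (hJ.mem_nhds hJ₀) hV
    (by filter_upwards [hJ.mem_nhds hJ₀] with s hs using hN s hs) hl ?_ ?_ ?_ ?_ ?_ <;>
    simp only [innL_apply, hi]
  · intro i hi'
    interval_cases i
    · simpa using h0 2 le_rfl s₀ hJ₀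
    · rw [iteratedDeriv_one (f := Γ.CH), hV0, inn_zero_right]
  · rw [r22]
    exact neg_ne_zero.2 h4
  · intro i hi'
    interval_cases i
    · simpa using h0 1 one_le_two s₀ hJ₀
    · rw [iteratedDeriv_one (f := Γ.CH), hV0, inn_zero_right]
    · exact r12
  · rw [r13]
    exact mul_ne_zero two_ne_zero h4
  · intro i hi'
    interval_cases i
    · simpa using h0 0 zero_le_two s₀ hJ₀
    · rw [iteratedDeriv_one (f := Γ.CH), hV0, inn_zero_right]

end CurveInHypersurface

end Minkowski

theorem proposition3p7 (Γ : Minkowski.CurveInHypersurface)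
    (hkg : ∀ s ∈ Γ.I, Γ.kg s ≠ 0)
    (hτ : ∀ s ∈ Γ.I, Γ.kn s * Γ.τ2 s + Γ.kg s * Γ.τg s ≠ 0)
    (hk : ∀ s ∈ Γ.I, Γ.kn s ^ 2 < Γ.kg s ^ 2)
    (s₀ : ℝ) (hs₀ : s₀ ∈ Γ.I) (θ₀ : ℝ)
    (v₀ : Minkowski.R41) (hv₀ : v₀ = Γ.S s₀ θ₀)
    (c : ℝ) (hc : c = Minkowski.inn (Γ.γ s₀) v₀) :
    -- (1), first part, for finite orders, and with infinite order of vanishing included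
    (((∃ k ≥ 3, Minkowski.HasContact (Minkowski.heightFn v₀ c) Γ.γ k s₀) ↔
        ∃ k ≥ 2, Minkowski.HasASingularity (Γ.hT v₀) k s₀) ∧
      (Minkowski.VanishesToOrder (Minkowski.heightFn v₀ c ∘ Γ.γ) 3 s₀ ↔
        Minkowski.VanishesToOrder (Γ.hT v₀) 2 s₀)) ∧
    -- (1), second part: the hyperbolic curve is defined near `s₀`, passes through `v₀`, and is
    -- locally diffeomorphic to a line
    (Minkowski.HasContact (Minkowski.heightFn v₀ c) Γ.γ 3 s₀ →
      |Γ.tanhAngle s₀| < 1 ∧ Γ.CH s₀ = v₀ ∧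
      Minkowski.ImageGermDiffeomorphic Minkowski.H3 Γ.CH s₀ Minkowski.lineModel 0) ∧
    -- (2)
    (Minkowski.HasContact (Minkowski.heightFn v₀ c) Γ.γ 4 s₀ ↔
      Minkowski.HasASingularity (Γ.hT v₀) 3 s₀) ∧
    (Minkowski.HasContact (Minkowski.heightFn v₀ c) Γ.γ 4 s₀ → Γ.lam0 s₀ ≠ 0 →
      |Γ.tanhAngle s₀| < 1 ∧ Γ.CH s₀ = v₀ ∧
      Minkowski.ImageGermDiffeomorphic Minkowski.H3 Γ.CH s₀ Minkowski.cusp234 0) := by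
  subst hv₀ hc
  refine ⟨⟨⟨?_, ?_⟩, Minkowski.CurveInHypersurface.vanishesToOrder_succ_heightFn_iff _ hs₀ 2⟩, ?_,
    Minkowski.CurveInHypersurface.hasContact_succ_iff _ hs₀ 3, ?_⟩
  · rintro ⟨_ | k, hk3, h⟩
    · omega
    · exact ⟨k, by omega, (Minkowski.CurveInHypersurface.hasContact_succ_iff _ hs₀ k).1 h⟩
  · rintro ⟨k, hk2, h⟩
    exact ⟨k + 1, by omega, (Minkowski.CurveInHypersurface.hasContact_succ_iff _ hs₀ k).2 h⟩
  · intro h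
    obtain ⟨h2, h3⟩ := (Minkowski.CurveInHypersurface.hasContact_succ_iff _ hs₀ 2).1 h
    obtain ⟨ha, hCH⟩ := Minkowski.CurveInHypersurface.CH_eq_of_vanishesToOrder hkg hτ hk hs₀ h2
    rw [Minkowski.CurveInHypersurface.iteratedDeriv_hT _ _ hs₀, ← hCH] at h3
    exact ⟨ha, hCH,
      Minkowski.CurveInHypersurface.imageGermDiffeomorphic_CH_lineModel hkg hτ hk hs₀ ha h3⟩
  · intro h _
    obtain ⟨h3, h4⟩ := (Minkowski.CurveInHypersurface.hasContact_succ_iff _ hs₀ 3).1 h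
    obtain ⟨ha, hCH⟩ := Minkowski.CurveInHypersurface.CH_eq_of_vanishesToOrder hkg hτ hk hs₀
      fun i hi => h3 i (by omega)
    have h3 := h3 3 le_rfl
    rw [Minkowski.CurveInHypersurface.iteratedDeriv_hT _ _ hs₀, ← hCH] at h3 h4
    exact ⟨ha, hCH,
      Minkowski.CurveInHypersurface.imageGermDiffeomorphic_CH_cusp234 hkg hτ hk hs₀ ha h3 h4⟩
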